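/- Let $N\ge 1$, let $\Omega\subseteq\mathbb{R}^N$ be an open set and let $1\le p<\infty$. For a vector field $u$ with values in $\mathbb{R}^N$ let $\nabla_{\mathrm{sym}}u=\big(\tfrac12(\partial_iu_j+\partial_ju_i)\big)_{i,j=1}^N$ be its symmetric gradient; $|\cdot|$ denotes the Euclidean norm of vectors and the Frobenius norm of matrices. Set $$C_{p,N}:=\big(2+|p-2|+\sqrt N\big)\frac{p}{p+N},\qquad \kappa_{p,\Omega}:=(\operatorname{diam}\Omega)\,C_{p,N},\qquad \kappa_{p,\partial\Omega}:=p\,\frac{p+1}{p+N}\,\operatorname{diam}\Omega .$$ Then $C_{p,N}>0$, for bounded nonempty $\Omega$ also $\kappa_{p,\Omega}>0$ and $\kappa_{p,\partial\Omega}>0$, and the following Poincaré–Korn inequalities hold. (i) For all $u\in C_c^\infty(\Omega,\mathbb{R}^N)$, $$\int_\Omega|u|^p\,dx\le C_{p,N}^p\int_\Omega|x|^p\,|\nabla_{\mathrm{sym}}u|^p\,dx .$$ If $\Omega$ is bounded, then also, for all $u\in C_c^\infty(\Omega,\mathbb{R}^N)$, $$\int_\Omega|u|^p\,dx\le \kappa_{p,\Omega}^p\int_\Omega|\nabla_{\mathrm{sym}}u|^p\,dx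 .$$ (ii) If $\Omega$ is bounded with Lipschitz boundary (near each boundary point, in suitable Cartesian coordinates, $\Omega$ is the region strictly below the graph of a Lipschitz function), then $$\int_\Omega|u|^p\,dx\le \kappa_{p,\Omega}^p\int_\Omega|\nabla_{\mathrm{sym}}u|^p\,dx+\kappa_{p,\partial\Omega}\int_{\partial\Omega}|u|^p\,d\mathcal{H}^{N-1}$$ for all $u\in C^\infty(\overline\Omega,\mathbb{R}^N)$, i.e. all $u$ that are smooth in $\Omega$, continuous on $\overline\Omega$, and whose derivatives of every order extend continuously to $\overline\Omega$. Here $\mathcal{H}^{N-1}$ is the $(N-1)$-dimensional Hausdorff (surface) measure, normalized to agree with Lebesgue measure on hyperplanes. -/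

import Mathlib

open MeasureTheory
open scoped ENNReal Distributions ContDiff RealInnerProductSpace Matrix.Norms.Frobenius

noncomputable section

namespace PoincareKorn

/-- The symmetric gradient `(1/2) (∇u + ∇ᵀu)` of a vector field `u` at `x`: its `(i, j)` entry is
`(∂ᵢ uⱼ + ∂ⱼ uᵢ) / 2`. Matrices carry the Frobenius norm. -/
def symGrad {N : ℕ} (u : EuclideanSpace ℝ (Fin N) → EuclideanSpace ℝ (Fin N))
    (x : EuclideanSpace ℝ (Fin N)) : Matrix (Fin N) (Fin N) ℝ :=
  Matrix.of fun i j =>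
    ((fderiv ℝ u x (EuclideanSpace.single i 1)) j +
      (fderiv ℝ u x (EuclideanSpace.single j 1)) i) / 2

/-- `u ∈ C^∞(Ω̄)`: `u` is smooth in the open set `Ω`, it is continuous on the closure (so its
boundary values are the limits from inside), and the derivatives of every order extend
continuously from `Ω` to the closure. -/
def SmoothUpToBoundary {N : ℕ} (Ω : Set (EuclideanSpace ℝ (Fin N)))
    (u : EuclideanSpace ℝ (Fin N) → EuclideanSpace ℝ (Fin N)) : Prop :=
  ContDiffOn ℝ ∞ u Ω ∧ ContinuousOn u (closure Ω) ∧
    ∀ k : ℕ, ∃ g : EuclideanSpace ℝ (Fin N) →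
        ContinuousMultilinearMap ℝ (fun _ : Fin k => EuclideanSpace ℝ (Fin N))
          (EuclideanSpace ℝ (Fin N)),
      ContinuousOn g (closure Ω) ∧ ∀ x ∈ Ω, g x = iteratedFDeriv ℝ k u x

/-- `Ω` has Lipschitz boundary: near every boundary point, in the orthogonal splitting
`ℝ e ⊕ e^⊥` given by some unit vector `e`, the set `Ω` is the region strictly below the graph of a
Lipschitz function `γ : e^⊥ → ℝ`. -/
def HasLipschitzBoundary {N : ℕ} (Ω : Set (EuclideanSpace ℝ (Fin N))) : Prop :=
  ∀ ξ ∈ frontier Ω, ∃ e : EuclideanSpace ℝ (Fin N), ‖e‖ = 1 ∧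
    ∃ r : ℝ, 0 < r ∧ ∃ (K : NNReal) (γ : (Submodule.span ℝ {e})ᗮ → ℝ), LipschitzWith K γ ∧
      ∀ x ∈ Metric.ball ξ r,
        (x ∈ Ω ↔ ⟪e, x⟫ < γ ((Submodule.span ℝ {e})ᗮ.orthogonalProjectionOnto x))

/-- The constant `C_{p,N} = (2 + |p - 2| + √N) p / (p + N)`. -/
def constC (p : ℝ) (N : ℕ) : ℝ := (2 + |p - 2| + √N) * (p / (p + N))

/-- The constant `κ_{p,Ω} = diam(Ω) C_{p,N}`. -/
def constKappa {N : ℕ} (p : ℝ) (Ω : Set (EuclideanSpace ℝ (Fin N))) : ℝ :=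
  Metric.diam Ω * constC p N

/-- The constant `κ_{p,∂Ω} = p (p + 1) / (p + N) diam(Ω)`. -/
def constKappaBdry {N : ℕ} (p : ℝ) (Ω : Set (EuclideanSpace ℝ (Fin N))) : ℝ :=
  p * ((p + 1) / (p + N)) * Metric.diam Ω

end PoincareKorn

end

/-! Fix a centre `x₀`, write `z = x - x₀`, let `E` be the symmetric gradient, and consider `F =
|u|^p z + p |u|^(p-2) ⟨u, z⟩ u`. Differentiating `|u|^p` along `z` produces `⟨u, Du z⟩`, which `E`
does not control; the second summand of `F` supplies the missing partner `⟨Du u, z⟩`, and the sum is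
`2 ⟨z, E u⟩`. The other first-order terms of `div F` contain only `⟨u, E u⟩` and `tr E`. By
Cauchy–Schwarz, `(p + N) |u|^p ≤ div F + p (2 + |p - 2| + √N) |u|^(p-1) |z| |E|`. After
multiplication by `p / (p + N)`, Young's inequality absorbs `(p - 1) |u|^p` and leaves `|u|^p ≤ (C
|z| |E|)^p + p / (p + N) div F` with `C = C_{p,N}` (`rpow_le_divergence_kornField`, where `|u|²` is
replaced by `|u|² + ε` to make the field differentiable).

Upon integration the flux of `F` vanishes for compactly supported `u`. Otherwise it is at most the
boundary integral of `|F| ≤ (1 + p) |z| |u|^p`. Taking `x₀ = 0` keeps the weight; taking `x₀ ∈ Ω`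
bounds it by the diameter.

Only this one-sided divergence theorem is needed, and it holds for every bounded open set with
boundary of finite surface measure (`RegularOn.integral_divergence_le`). For a directional
derivative it follows from difference quotients: `Ω` and its translate by `t v` differ inside a tube
over the boundary, whose volume is at most about `t` times the surface measure. A partition of
unity, on whose pieces the field is almost constant, passes to vector fields without a dimensional
factor. The Lipschitz graphs give the finiteness of the surface measure. -/

namespace PoincareKorn

open Set Filter Topology Module

/-! ### Volume of tubes and integrals over them. -/

section Tube

variable {X Y : Type*} [MetricSpace X] [MeasurableSpace X] [BorelSpace X]
  [MetricSpace Y] [MeasurableSpace Y] [BorelSpace Y]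

/-- Lipschitz maps increase the Euclidean Hausdorff measure by at most the factor `K ^ d`. -/
theorem euclideanHausdorffMeasure_image_le {K : NNReal} {f : X → Y} (hf : LipschitzWith K f)
    (d : ℕ) (s : Set X) : μHE[d] (f '' s) ≤ (K : ℝ≥0∞) ^ d * μHE[d] s := by
  simp only [Measure.euclideanHausdorffMeasure_def, Measure.smul_apply]
  rw [ENNReal.smul_def, ENNReal.smul_def, smul_eq_mul, smul_eq_mul, mul_left_comm]
  gcongr
  simpa using hf.hausdorffMeasure_image_le (d := d) (by positivity) s

variable {V : Type*} [NormedAddCommGroup V] [InnerProductSpace ℝ V]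

/-- The set swept out by `A` when it is translated by `s • v`, `0 ≤ s ≤ t`. -/
def tube (A : Set V) (v : V) (t : ℝ) : Set V := {x | ∃ s ∈ Icc 0 t, x - s • v ∈ A}

theorem tube_iUnion {ι : Type*} (A : ι → Set V) (v : V) (t : ℝ) :
    tube (⋃ i, A i) v t = ⋃ i, tube (A i) v t := by
  ext x
  simp only [tube, mem_ofPred_eq, mem_iUnion]
  constructor
  · rintro ⟨s, hs, i, h⟩; exact ⟨i, s, hs, h⟩
  · rintro ⟨i, s, hs, h⟩; exact ⟨s, hs, i, h⟩

variable [FiniteDimensional ℝ V]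

theorem finrank_orthogonal_span_singleton_eq {v : V} (hv : v ≠ 0) :
    finrank ℝ (ℝ ∙ v)ᗮ = finrank ℝ V - 1 := by
  have := (ℝ ∙ v).finrank_add_finrank_orthogonal
  rw [finrank_span_singleton hv] at this
  omega

variable [MeasurableSpace V] [BorelSpace V]

/-- The tube over a set contained in a ball of radius `r` has volume at most `t + 2 r` times the
`(n - 1)`-dimensional measure of the set. -/
theorem volume_tube_le {v : V} (hv : ‖v‖ = 1) {B : Set V} {y : V} {r t : ℝ}
    (hB : B ⊆ Metric.ball y r) :
    volume (tube B v t) ≤ ENNReal.ofReal (t + 2 * r) * μHE[finrank ℝ V - 1] B := by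
  have hv0 : v ≠ 0 := by rintro rfl; simp at hv
  set L : Submodule ℝ V := ℝ ∙ v
  let e := LinearIsometryEquiv.toSpanUnitSingleton (𝕜 := ℝ) v hv
  have he : ∀ s : ℝ, ((e s : L) : V) = s • v := fun s => rfl
  let c : ℝ := ⟪v, y⟫
  let I : Set ℝ := Icc (c - r) (c + r + t)
  have hdec : ∀ x : V, L.orthogonalProjectionOnto x = e ⟪v, x⟫ := by
    intro x
    apply Subtype.ext
    rw [he]
    exact Submodule.starProjection_unit_singleton ℝ hv x
  -- The tube lies in a box: along `v` an interval of length `t + 2 r`, across `v` the projection of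
  -- `B`, whose measure does not exceed that of `B`.
  have hsub : tube B v t ⊆ (L.measurableEquivProd (0 : V)) ⁻¹'
      ((e '' I) ×ˢ (Lᗮ.orthogonalProjectionOnto '' B)) := by
    rintro x ⟨s, ⟨hs0, hst⟩, hx⟩
    have h1 := hB hx
    rw [Metric.mem_ball, dist_eq_norm] at h1
    have h2 : |⟪v, x - s • v - y⟫| < r := by
      refine (abs_real_inner_le_norm _ _).trans_lt ?_
      rwa [hv, one_mul]
    have h3 : ⟪v, x - s • v - y⟫ = ⟪v, x⟫ - s - c := by
      simp [inner_sub_right, inner_smul_right, hv, c]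
    rw [h3, abs_lt] at h2
    simp only [mem_preimage, Submodule.measurableEquivProd_apply, vsub_eq_sub, sub_zero, mem_prod]
    refine ⟨⟨⟪v, x⟫, ⟨by linarith [h2.1], by linarith [h2.2]⟩, (hdec x).symm⟩,
      ⟨x - s • v, hx, ?_⟩⟩
    rw [map_sub, map_smul]
    have : Lᗮ.orthogonalProjectionOnto v = 0 :=
      Submodule.orthogonalProjectionOnto_orthogonalComplement_singleton_eq_zero v
    simp [this]
  have hmp := L.measurePreserving_measurableEquivProd (0 : V)
  rw [InnerProductSpace.euclideanHausdorffMeasure_eq_volume] at hmp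
  calc volume (tube B v t) ≤ volume ((L.measurableEquivProd (0 : V)) ⁻¹'
      ((e '' I) ×ˢ (Lᗮ.orthogonalProjectionOnto '' B))) := measure_mono hsub
    _ = volume (e '' I) * volume (Lᗮ.orthogonalProjectionOnto '' B) := by
      rw [hmp.measure_preimage_equiv, Measure.volume_eq_prod, Measure.prod_prod]
    _ ≤ _ := by
      gcongr
      · have : e '' I = e.symm ⁻¹' I := e.toEquiv.image_eq_preimage_symm I
        rw [this, e.symm.measurePreserving.measure_preimage
          measurableSet_Icc.nullMeasurableSet, Real.volume_Icc]
        gcongr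
        linarith
      · rw [← InnerProductSpace.euclideanHausdorffMeasure_eq_volume,
          finrank_orthogonal_span_singleton_eq hv0]
        refine (euclideanHausdorffMeasure_image_le (K := 1) ?_ _ _).trans (by simp)
        exact LipschitzWith.of_dist_le_mul fun x z => by
          rw [dist_eq_norm, ← map_sub, dist_eq_norm]
          simpa using Lᗮ.norm_orthogonalProjectionOnto_apply_le (x - z)

/-- Integrals over a thin tube are controlled by integrals over its base. -/
theorem lintegral_tube_le {v : V} (hv : ‖v‖ = 1) {A : Set V} (hA : MeasurableSet A)
    {g : V → ℝ≥0∞} {η : ℝ≥0∞} {δ t : ℝ} (hδ : 0 < δ) (ht : 0 ≤ t)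
    (hg : ∀ x y, dist x y ≤ t + δ → g x ≤ g y + η) :
    ∫⁻ x in tube A v t, g x ≤
      ENNReal.ofReal (t + 2 * δ) * ∫⁻ x in A, (g x + 2 * η) ∂μHE[finrank ℝ V - 1] := by
  let y : ℕ → V := TopologicalSpace.denseSeq V
  -- A countable Borel partition of the space into pieces of radius `δ`. On each piece `g` is
  -- compared with its value at the centre `y n`, once from the tube and once back to the base,
  -- whence `2 * η`.
  let D : ℕ → Set V := disjointed fun n => Metric.ball (y n) δ
  have hDm : ∀ n, MeasurableSet (D n) :=
    fun n => MeasurableSet.disjointed (fun n => Metric.isOpen_ball.measurableSet) n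
  have hDs : ∀ n, D n ⊆ Metric.ball (y n) δ := fun n => disjointed_subset _ n
  have hDu : ⋃ n, D n = univ := by
    rw [iUnion_disjointed]
    refine eq_univ_of_forall fun x => mem_iUnion.2 ?_
    obtain ⟨n, hn⟩ := (TopologicalSpace.denseRange_denseSeq V).exists_dist_lt x hδ
    exact ⟨n, hn⟩
  have hAu : A = ⋃ n, A ∩ D n := by rw [← inter_iUnion, hDu, inter_univ]
  calc ∫⁻ x in tube A v t, g x = ∫⁻ x in ⋃ n, tube (A ∩ D n) v t, g x := by
        rw [← tube_iUnion, ← hAu]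
    _ ≤ ∑' n, ∫⁻ x in tube (A ∩ D n) v t, g x := lintegral_iUnion_le _ _
    _ ≤ ∑' n, ENNReal.ofReal (t + 2 * δ) *
          ∫⁻ x in A ∩ D n, (g x + 2 * η) ∂μHE[finrank ℝ V - 1] := by
        refine ENNReal.tsum_le_tsum fun n => ?_
        calc ∫⁻ x in tube (A ∩ D n) v t, g x
            ≤ ∫⁻ x in tube (A ∩ D n) v t, (g (y n) + η) := by
              refine setLIntegral_mono measurable_const ?_
              rintro x ⟨s, ⟨hs0, hst⟩, hx⟩
              refine hg _ _ ?_
              have h1 := Metric.mem_ball.1 (hDs n hx.2)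
              calc dist x (y n) ≤ dist x (x - s • v) + dist (x - s • v) (y n) :=
                    dist_triangle _ _ _
                _ ≤ t + δ := by
                    gcongr
                    rw [dist_eq_norm]
                    simpa [norm_smul, hv, abs_of_nonneg hs0] using hst
          _ = (g (y n) + η) * volume (tube (A ∩ D n) v t) := by
              rw [setLIntegral_const]
          _ ≤ (g (y n) + η) *
                (ENNReal.ofReal (t + 2 * δ) * μHE[finrank ℝ V - 1] (A ∩ D n)) := by
              gcongr
              exact volume_tube_le hv (inter_subset_right.trans (hDs n))
          _ = ENNReal.ofReal (t + 2 * δ) *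
                ∫⁻ x in A ∩ D n, (g (y n) + η) ∂μHE[finrank ℝ V - 1] := by
              rw [setLIntegral_const]; ring
          _ ≤ _ := by
              refine mul_le_mul_right ?_ _
              refine setLIntegral_mono' (hA.inter (hDm n)) fun x hx => ?_
              have h1 := Metric.mem_ball'.1 (hDs n hx.2)
              calc g (y n) + η ≤ g x + η + η := by
                    gcongr; exact hg _ _ (by linarith)
                _ = _ := by ring
    _ = _ := by
        rw [ENNReal.tsum_mul_left, ← lintegral_iUnion (fun n => hA.inter (hDm n)), ← hAu]
        exact fun i j hij => ((disjoint_disjointed _) hij).mono inter_subset_right inter_subset_right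

end Tube

/-! ### Directional derivatives and the boundary integral. -/

section Directional

variable {V : Type*} [NormedAddCommGroup V] [InnerProductSpace ℝ V]

/-- A segment is connected, so it cannot be split between the interior of `Ω` and the complement of
its closure. -/
theorem exists_mem_frontier_of_segment {Ω : Set V} {x v : V} {t a b : ℝ}
    (ha : a ∈ Icc 0 t) (hb : b ∈ Icc 0 t) (hx : x + a • v ∈ Ω) (hy : x + b • v ∉ Ω) :
    ∃ s ∈ Icc (0 : ℝ) t, x + s • v ∈ frontier Ω := by
  have hpre : IsPreconnected ((fun s : ℝ => x + s • v) '' Icc 0 t) :=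
    isPreconnected_Icc.image _ (by fun_prop)
  by_contra! hcon
  have hcov : ∀ s ∈ Icc (0 : ℝ) t, x + s • v ∈ interior Ω ∨ x + s • v ∈ (closure Ω)ᶜ := by
    intro s hs
    by_contra! h
    exact hcon s hs ⟨not_not.1 h.2, h.1⟩
  obtain ⟨_, -, h1, h2⟩ := hpre _ _ isOpen_interior isClosed_closure.isOpen_compl
    (by rintro _ ⟨s, hs, rfl⟩; exact hcov s hs)
    ⟨_, mem_image_of_mem _ ha, (hcov a ha).resolve_right fun h => h (subset_closure hx)⟩
    ⟨_, mem_image_of_mem _ hb, (hcov b hb).resolve_left fun h => hy (interior_subset h)⟩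
  exact h2 (subset_closure (interior_subset h1))

/-- The points from which the segment of length `t` in direction `v` stays in `Ω`. -/
def segmentCore (Ω : Set V) (v : V) (t : ℝ) : Set V := {x | ∀ s ∈ Icc (0 : ℝ) t, x + s • v ∈ Ω}

theorem isOpen_segmentCore {Ω : Set V} (ho : IsOpen Ω) (v : V) (t : ℝ) :
    IsOpen (segmentCore Ω v t) := by
  rw [isOpen_iff_mem_nhds]
  intro x hx
  -- Compactness of `[0, t]` makes the neighbourhood of `x` uniform in `s`.
  have := isCompact_Icc.eventually_forall_of_forall_eventually (x₀ := x)
    (K := Icc (0 : ℝ) t) (P := fun x s => x + s • v ∈ Ω) fun s hs =>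
      (ho.preimage (f := fun z : V × ℝ => z.1 + z.2 • v) (by fun_prop)).mem_nhds (hx s hs)
  exact this

theorem segmentCore_subset {Ω : Set V} {v : V} {t : ℝ} (ht : 0 ≤ t) : segmentCore Ω v t ⊆ Ω :=
  fun x hx => by simpa using hx 0 ⟨le_rfl, ht⟩

theorem eventually_mem_segmentCore {Ω : Set V} (ho : IsOpen Ω) (v : V) {x : V} (hx : x ∈ Ω) :
    ∀ᶠ t in 𝓝[>] (0 : ℝ), x ∈ segmentCore Ω v t := by
  have hc : Continuous fun s : ℝ => x + s • v := by fun_prop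
  have h0 : ∀ᶠ s in 𝓝 (0 : ℝ), x + s • v ∈ Ω :=
    hc.continuousAt.eventually (ho.mem_nhds (by simpa using hx))
  obtain ⟨ε, hε, h⟩ := Metric.eventually_nhds_iff.1 h0
  filter_upwards [Ioo_mem_nhdsGT hε] with t ht s hs
  apply h
  rw [Real.dist_eq, sub_zero, abs_of_nonneg hs.1]
  exact hs.2.trans_lt ht.2

theorem diff_segmentCore_subset_tube {Ω : Set V} {v : V} {t : ℝ} (ht : 0 ≤ t) :
    Ω \ segmentCore Ω v t ⊆ tube (frontier Ω) (-v) t := by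
  rintro x ⟨hx, hG⟩
  simp only [segmentCore, mem_ofPred_eq, not_forall] at hG
  obtain ⟨s, hs, h⟩ := hG
  obtain ⟨r, hr, hr'⟩ := exists_mem_frontier_of_segment (v := v) (a := 0) ⟨le_rfl, ht⟩ hs
    (by simpa using hx) h
  exact ⟨r, hr, by simpa using hr'⟩

theorem abs_sub_le_of_mem_segmentCore {Ω : Set V} {v : V} (hv : ‖v‖ = 1) {f : V → ℝ} {M t : ℝ}
    (hd : ∀ x ∈ Ω, DifferentiableAt ℝ f x) (hM : ∀ x ∈ Ω, ‖fderiv ℝ f x‖ ≤ M) (ht : 0 ≤ t) {x : V}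
    (hx : x ∈ segmentCore Ω v t) : |f (x + t • v) - f x| ≤ M * t := by
  have hseg : ∀ y ∈ segment ℝ x (x + t • v), y ∈ Ω := by
    rw [segment_eq_image']
    rintro _ ⟨θ, hθ, rfl⟩
    have := hx (θ * t) ⟨by have := hθ.1; positivity, mul_le_of_le_one_left ht hθ.2⟩
    simpa [smul_smul] using this
  have := (convex_segment x (x + t • v)).norm_image_sub_le_of_norm_fderiv_le
    (fun y hy => hd y (hseg y hy)) (fun y hy => hM y (hseg y hy))
    (left_mem_segment ℝ _ _) (right_mem_segment ℝ _ _)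
  simpa [norm_smul, hv, abs_of_nonneg ht] using this

variable [FiniteDimensional ℝ V] [MeasurableSpace V] [BorelSpace V]

/-- Dominated convergence. Nothing is known about derivatives of `f` outside `Ω`, so the quotients
are kept only where the whole segment lies in `Ω`; there the mean value inequality bounds them by
`M`. -/
theorem tendsto_integral_segmentCore {v : V} (hv : ‖v‖ = 1) {Ω : Set V} (ho : IsOpen Ω)
    (hb : Bornology.IsBounded Ω) {f : V → ℝ} (hf : Continuous f)
    (hd : ∀ x ∈ Ω, DifferentiableAt ℝ f x) {M : ℝ} (hM : ∀ x ∈ Ω, ‖fderiv ℝ f x‖ ≤ M) :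
    Tendsto (fun t : ℝ => t⁻¹ * ∫ x in segmentCore Ω v t, (f (x + t • v) - f x)) (𝓝[>] 0)
      (𝓝 (∫ x in Ω, fderiv ℝ f x v)) := by
  have : IsFiniteMeasure (volume.restrict Ω) := ⟨by simpa using hb.measure_lt_top⟩
  have key : Tendsto (fun t : ℝ => ∫ x in Ω, (segmentCore Ω v t).indicator
      (fun x => t⁻¹ * (f (x + t • v) - f x)) x) (𝓝[>] 0) (𝓝 (∫ x in Ω, fderiv ℝ f x v)) := by
    refine tendsto_integral_filter_of_dominated_convergence (fun _ => M) ?_ ?_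
      (integrable_const M) ?_
    · refine Eventually.of_forall fun t => ?_
      refine (Measurable.indicator ?_ (isOpen_segmentCore ho v t).measurableSet).aestronglyMeasurable
      have : Continuous fun x => t⁻¹ * (f (x + t • v) - f x) := by fun_prop
      exact this.measurable
    · filter_upwards [self_mem_nhdsWithin] with t ht
      have ht : 0 < t := ht
      filter_upwards [ae_restrict_mem ho.measurableSet] with x hx
      by_cases hG : x ∈ segmentCore Ω v t
      · rw [indicator_of_mem hG, Real.norm_eq_abs, abs_mul, abs_of_pos (inv_pos.2 ht),
          inv_mul_le_iff₀ ht, mul_comm]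
        exact abs_sub_le_of_mem_segmentCore hv hd hM ht.le hG
      · rw [indicator_of_notMem hG, norm_zero]
        exact (norm_nonneg _).trans (hM x hx)
    · filter_upwards [ae_restrict_mem ho.measurableSet] with x hx
      have h1 := ((hd x hx).hasFDerivAt.hasLineDerivAt v).tendsto_slope_zero_right
      refine h1.congr' ?_
      filter_upwards [eventually_mem_segmentCore ho v hx] with t ht
      rw [indicator_of_mem ht, smul_eq_mul]
  refine key.congr' ?_
  filter_upwards [self_mem_nhdsWithin] with t ht
  rw [setIntegral_indicator (isOpen_segmentCore ho v t).measurableSet,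
    inter_eq_right.2 (segmentCore_subset (le_of_lt ht)), integral_const_mul]

/-- The left side is the difference of the integrals of `f` over `Ω + t v` and over `Ω`. A point in
exactly one of these sets starts a backward segment that crosses the boundary. -/
theorem enorm_integral_translate_sub_le {v : V} {Ω : Set V} (ho : IsOpen Ω) {f : V → ℝ}
    (hf : Integrable f) {t : ℝ} (ht : 0 ≤ t) :
    ‖∫ x in Ω, (f (x + t • v) - f x)‖ₑ ≤ ∫⁻ x in tube (frontier Ω) v t, ‖f x‖ₑ := by
  have hpre : MeasurableSet ((fun x => x - t • v) ⁻¹' Ω) :=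
    (ho.preimage (by fun_prop)).measurableSet
  have h1 : ∫ x in Ω, f (x + t • v) = ∫ x in (fun x => x - t • v) ⁻¹' Ω, f x := by
    rw [← integral_indicator ho.measurableSet, ← integral_indicator hpre,
      ← integral_add_right_eq_self (((fun x => x - t • v) ⁻¹' Ω).indicator f) (t • v)]
    congr 1 with x
    have hiff : x + t • v ∈ (fun x => x - t • v) ⁻¹' Ω ↔ x ∈ Ω := by
      rw [mem_preimage, add_sub_cancel_right]
    by_cases hx : x ∈ Ω
    · rw [indicator_of_mem hx, indicator_of_mem (hiff.2 hx)]
    · rw [indicator_of_notMem hx, indicator_of_notMem (mt hiff.1 hx)]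
  have h2 : ∫ x in Ω, (f (x + t • v) - f x) =
      ∫ x, (((fun x => x - t • v) ⁻¹' Ω).indicator f x - Ω.indicator f x) := by
    rw [integral_sub (hf.comp_add_right (t • v)).integrableOn hf.integrableOn, h1,
      integral_sub (hf.indicator hpre) (hf.indicator ho.measurableSet),
      integral_indicator hpre, integral_indicator ho.measurableSet]
  rw [h2]
  refine (enorm_integral_le_lintegral_enorm _).trans
    (le_trans (lintegral_mono fun x => ?_) (lintegral_indicator_le _ _))
  by_cases hx : x ∈ tube (frontier Ω) v t
  · rw [indicator_of_mem hx]
    by_cases ha : x - t • v ∈ Ω <;> by_cases hb : x ∈ Ω <;> simp [indicator, ha, hb]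
  · have hiff : x - t • v ∈ Ω ↔ x ∈ Ω := by
      by_contra hne
      apply hx
      have : ∃ s ∈ Icc (0 : ℝ) t, x + s • (-v) ∈ frontier Ω := by
        rcases (not_iff.1 hne) with h
        by_cases hxΩ : x ∈ Ω
        · exact exists_mem_frontier_of_segment (a := 0) (b := t) ⟨le_rfl, ht⟩ ⟨ht, le_rfl⟩
            (by simpa using hxΩ) (by simpa [sub_eq_add_neg] using fun h' => (h.2 hxΩ) h')
        · exact exists_mem_frontier_of_segment (a := t) (b := 0) ⟨ht, le_rfl⟩ ⟨le_rfl, ht⟩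
            (by simpa [sub_eq_add_neg] using not_not.1 (mt h.1 hxΩ)) (by simpa using hxΩ)
      obtain ⟨s, hs, h⟩ := this
      exact ⟨s, hs, by simpa [sub_eq_add_neg] using h⟩
    by_cases hb : x ∈ Ω
    · simp [indicator, hb, hiff.2 hb]
    · simp [indicator, hb, mt hiff.1 hb]

/-- The integral over the core is the one over `Ω` minus the one over the remainder. The former is a
tube integral, with error `2 η`; on the remainder, also inside a tube, the increment is at most `η`.
Together these give `3 η`. -/
theorem integral_segmentCore_le {v : V} (hv : ‖v‖ = 1) {Ω : Set V} (ho : IsOpen Ω)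
    (hb : Bornology.IsBounded Ω) (hH : μHE[finrank ℝ V - 1] (frontier Ω) ≠ ⊤)
    {f : V → ℝ} (hf : Continuous f) (hc : HasCompactSupport f) {η t ρ : ℝ} (hη : 0 < η)
    (hu : ∀ x y, dist x y < ρ → dist (f x) (f y) < η) (ht : 0 < t) (htρ : (1 + η) * t < ρ) :
    t⁻¹ * ∫ x in segmentCore Ω v t, (f (x + t • v) - f x) ≤
      (1 + η) * ((∫ x in frontier Ω, |f x| ∂μHE[finrank ℝ V - 1]) +
        3 * η * (μHE[finrank ℝ V - 1]).real (frontier Ω)) := by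
  have hfi : Integrable f := hf.integrable_of_hasCompactSupport hc
  have : IsFiniteMeasure ((μHE[finrank ℝ V - 1]).restrict (frontier Ω)) :=
    ⟨by simpa using hH.lt_top⟩
  have hfb : Integrable (fun x => |f x|) ((μHE[finrank ℝ V - 1]).restrict (frontier Ω)) := by
    obtain ⟨C, hC⟩ := hc.exists_bound_of_continuous hf
    refine Integrable.of_bound hf.abs.aestronglyMeasurable C (Eventually.of_forall fun x => ?_)
    simpa using hC x
  set B : ℝ := ∫ x in frontier Ω, |f x| ∂μHE[finrank ℝ V - 1]
  set h : ℝ := (μHE[finrank ℝ V - 1]).real (frontier Ω)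
  have hB : 0 ≤ B := integral_nonneg fun x => abs_nonneg _
  have hh : 0 ≤ h := measureReal_nonneg
  -- With pieces of radius `η t / 2` the tube thickness `t + 2 δ` becomes `(1 + η) t`, which is `t`
  -- to leading order.
  have hδ : 0 < η * t / 2 := by positivity
  have hexp : t + 2 * (η * t / 2) = (1 + η) * t := by ring
  have htube : ∫⁻ x in tube (frontier Ω) v t, ‖f x‖ₑ ≤
      ENNReal.ofReal ((1 + η) * t * (B + 2 * η * h)) := by
    refine (lintegral_tube_le hv isClosed_frontier.measurableSet (η := ENNReal.ofReal η) hδ ht.le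
      fun x y hxy => ?_).trans ?_
    · have h1 := hu x y (by nlinarith)
      rw [Real.dist_eq] at h1
      rw [← ofReal_norm, ← ofReal_norm, ← ENNReal.ofReal_add (norm_nonneg _) hη.le]
      apply ENNReal.ofReal_le_ofReal
      simp only [Real.norm_eq_abs]
      linarith [abs_sub_abs_le_abs_sub (f x) (f y)]
    · rw [hexp, ENNReal.ofReal_mul (p := (1 + η) * t) (by positivity)]
      refine mul_le_mul_right ?_ _
      rw [lintegral_add_right _ measurable_const, setLIntegral_const,
        ENNReal.ofReal_add hB (by positivity), ENNReal.ofReal_mul (by positivity),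
        ENNReal.ofReal_mul (by positivity), ofReal_measureReal hH]
      gcongr
      · rw [ofReal_integral_eq_lintegral_ofReal hfb (Eventually.of_forall fun x => abs_nonneg _)]
        refine lintegral_mono fun x => ?_
        rw [← ofReal_norm, Real.norm_eq_abs]
      · simp
  have hvol : volume.real (Ω \ segmentCore Ω v t) ≤ (1 + η) * t * h := by
    have h1 := lintegral_tube_le (v := -v) (by simpa using hv)
      (isClosed_frontier (s := Ω)).measurableSet (η := 0) (g := fun _ => 1) hδ ht.le (by simp)
    simp only [setLIntegral_const, hexp, mul_zero, add_zero, one_mul] at h1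
    have h2 := (measure_mono (diff_segmentCore_subset_tube (Ω := Ω) (v := v) ht.le)).trans h1
    rw [← ofReal_measureReal hH, ← ENNReal.ofReal_mul (by positivity)] at h2
    exact ENNReal.toReal_le_of_le_ofReal (by positivity) h2
  have hGm := (isOpen_segmentCore ho v t).measurableSet
  have hint : Integrable (fun x => f (x + t • v) - f x) :=
    (hfi.comp_add_right (t • v)).sub hfi
  have hsplit : ∫ x in segmentCore Ω v t, (f (x + t • v) - f x) =
      (∫ x in Ω, (f (x + t • v) - f x)) -
        ∫ x in Ω \ segmentCore Ω v t, (f (x + t • v) - f x) := by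
    rw [setIntegral_sdiff hGm hint.integrableOn (segmentCore_subset ht.le)]
    ring
  have h1 : ∫ x in Ω, (f (x + t • v) - f x) ≤ (1 + η) * t * (B + 2 * η * h) := by
    have := (enorm_integral_translate_sub_le (v := v) ho hfi ht.le).trans htube
    rw [← ofReal_norm, ENNReal.ofReal_le_ofReal_iff (by positivity)] at this
    exact (le_abs_self _).trans this
  have h2 : ‖∫ x in Ω \ segmentCore Ω v t, (f (x + t • v) - f x)‖ ≤
      η * volume.real (Ω \ segmentCore Ω v t) := by
    refine norm_setIntegral_le_of_norm_le_const
      ((measure_mono sdiff_subset).trans_lt hb.measure_lt_top) fun x _ => ?_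
    have := hu (x + t • v) x (by
      rw [dist_eq_norm, add_sub_cancel_left, norm_smul, hv, mul_one, Real.norm_eq_abs,
        abs_of_pos ht]
      nlinarith)
    rw [Real.dist_eq] at this
    exact this.le
  rw [inv_mul_le_iff₀ ht, hsplit]
  have h3 : η * volume.real (Ω \ segmentCore Ω v t) ≤ η * ((1 + η) * t * h) := by gcongr
  have h4 := (neg_le_abs _).trans h2
  nlinarith

/-- The boundary integral of `|f|` dominates the integral of a directional derivative of `f`. -/
theorem integral_fderiv_apply_le {v : V} (hv : ‖v‖ = 1) {Ω : Set V} (ho : IsOpen Ω)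
    (hb : Bornology.IsBounded Ω) (hH : μHE[finrank ℝ V - 1] (frontier Ω) ≠ ⊤)
    {f : V → ℝ} (hf : Continuous f) (hc : HasCompactSupport f)
    (hd : ∀ x ∈ Ω, DifferentiableAt ℝ f x) {M : ℝ} (hM : ∀ x ∈ Ω, ‖fderiv ℝ f x‖ ≤ M) :
    ∫ x in Ω, fderiv ℝ f x v ≤ ∫ x in frontier Ω, |f x| ∂μHE[finrank ℝ V - 1] := by
  set B : ℝ := ∫ x in frontier Ω, |f x| ∂μHE[finrank ℝ V - 1]
  set h : ℝ := (μHE[finrank ℝ V - 1]).real (frontier Ω)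
  have hbound : ∀ η : ℝ, 0 < η →
      ∫ x in Ω, fderiv ℝ f x v ≤ (1 + η) * (B + 3 * η * h) := by
    intro η hη
    obtain ⟨ρ, hρ, hu⟩ := Metric.uniformContinuous_iff.1 (hc.uniformContinuous_of_continuous hf) η hη
    refine le_of_tendsto (tendsto_integral_segmentCore hv ho hb hf hd hM) ?_
    filter_upwards [Ioo_mem_nhdsGT (show (0 : ℝ) < ρ / (1 + η) by positivity)] with t ht
    refine integral_segmentCore_le hv ho hb hH hf hc hη (fun x y hxy => hu hxy) ht.1 ?_
    have := ht.2
    rwa [lt_div_iff₀ (by positivity), mul_comm] at this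
  have hlim : Tendsto (fun η : ℝ => (1 + η) * (B + 3 * η * h)) (𝓝[>] 0) (𝓝 B) := by
    have : Continuous fun η : ℝ => (1 + η) * (B + 3 * η * h) := by fun_prop
    simpa using (this.tendsto 0).mono_left nhdsWithin_le_nhds
  exact ge_of_tendsto hlim (by filter_upwards [self_mem_nhdsWithin] with η hη using hbound η hη)

end Directional

/-! ### One-sided divergence theorem with boundary of finite measure. -/

section Divergence

/-- Compactly supported continuous maps on `V` which are differentiable with bounded derivative
in `Ω`. -/
structure RegularOn {V W : Type*} [NormedAddCommGroup V] [NormedSpace ℝ V]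
    [NormedAddCommGroup W] [NormedSpace ℝ W] (Ω : Set V) (F : V → W) : Prop where
  continuous : Continuous F
  hasCompactSupport : HasCompactSupport F
  differentiableAt : ∀ x ∈ Ω, DifferentiableAt ℝ F x
  bounded_fderiv : ∃ M, ∀ x ∈ Ω, ‖fderiv ℝ F x‖ ≤ M

variable {V W W' : Type*} [NormedAddCommGroup V] [NormedSpace ℝ V]
    [NormedAddCommGroup W] [NormedSpace ℝ W] [NormedAddCommGroup W'] [NormedSpace ℝ W'] {Ω : Set V}

/-- All auxiliary fields have the form `Φ (x, F x)`. The derivative of `Φ` is bounded along them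
because the closure of `Ω` is compact and `F` is continuous on it. -/
theorem RegularOn.comp_prodMk [ProperSpace V] {F : V → W} (hF : RegularOn Ω F)
    (hb : Bornology.IsBounded Ω) {Φ : V × W → W'} (hΦ : ContDiff ℝ 1 Φ)
    (hc : HasCompactSupport fun x => Φ (x, F x)) : RegularOn Ω fun x => Φ (x, F x) := by
  have hpair : ∀ x ∈ Ω, HasFDerivAt (fun x => Φ (x, F x))
      ((fderiv ℝ Φ (x, F x)).comp ((ContinuousLinearMap.id ℝ V).prod (fderiv ℝ F x))) x := by
    intro x hx
    have h1 : HasFDerivAt (fun x => (x, F x))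
        ((ContinuousLinearMap.id ℝ V).prod (fderiv ℝ F x)) x :=
      (hasFDerivAt_id x).prodMk (hF.differentiableAt x hx).hasFDerivAt
    have h2 : HasFDerivAt Φ (fderiv ℝ Φ (x, F x)) (x, F x) :=
      (hΦ.differentiable one_ne_zero).differentiableAt.hasFDerivAt
    exact h2.comp x h1
  refine ⟨hΦ.continuous.comp (continuous_id.prodMk hF.continuous), hc,
    fun x hx => (hpair x hx).differentiableAt, ?_⟩
  obtain ⟨M, hM⟩ := hF.bounded_fderiv
  have hcont : Continuous fun x => fderiv ℝ Φ (x, F x) :=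
    (hΦ.continuous_fderiv one_ne_zero).comp (continuous_id.prodMk hF.continuous)
  obtain ⟨K, hK⟩ := (hb.isCompact_closure).exists_bound_of_continuousOn hcont.continuousOn
  refine ⟨K * max 1 M, fun x hx => ?_⟩
  rw [(hpair x hx).fderiv]
  refine (ContinuousLinearMap.opNorm_comp_le _ _).trans ?_
  have hKx := hK x (subset_closure hx)
  refine mul_le_mul hKx ?_ (norm_nonneg _) ((norm_nonneg _).trans hKx)
  rw [ContinuousLinearMap.opNorm_prod, Prod.norm_def]
  exact max_le_max ContinuousLinearMap.norm_id_le (hM x hx)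

theorem RegularOn.clm_comp {F : V → W} (hF : RegularOn Ω F) (T : W →L[ℝ] W') :
    RegularOn Ω fun x => T (F x) := by
  obtain ⟨M, hM⟩ := hF.bounded_fderiv
  have hd : ∀ x ∈ Ω, HasFDerivAt (fun x => T (F x)) (T.comp (fderiv ℝ F x)) x :=
    fun x hx => T.hasFDerivAt.comp x (hF.differentiableAt x hx).hasFDerivAt
  refine ⟨T.continuous.comp hF.continuous, hF.hasCompactSupport.comp_left (map_zero T),
    fun x hx => (hd x hx).differentiableAt, ‖T‖ * M, fun x hx => ?_⟩
  rw [(hd x hx).fderiv]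
  exact (ContinuousLinearMap.opNorm_comp_le _ _).trans (by gcongr; exact hM x hx)

theorem RegularOn.integrable_fderiv_apply [MeasurableSpace V] [BorelSpace V]
    [FiniteDimensional ℝ V] [CompleteSpace W] [MeasurableSpace W] [BorelSpace W]
    [SecondCountableTopology W] {μ : Measure V} [IsFiniteMeasureOnCompacts μ]
    {F : V → W} (hF : RegularOn Ω F) (ho : IsOpen Ω)
    (hb : Bornology.IsBounded Ω) (v : V) : IntegrableOn (fun x => fderiv ℝ F x v) Ω μ := by
  obtain ⟨M, hM⟩ := hF.bounded_fderiv
  have := FiniteDimensional.proper_real V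
  refine IntegrableOn.of_bound hb.measure_lt_top
    (measurable_fderiv_apply_const ℝ F v).aestronglyMeasurable (M * ‖v‖) ?_
  filter_upwards [ae_restrict_mem ho.measurableSet] with x hx
  exact (ContinuousLinearMap.le_opNorm _ _).trans (by gcongr; exact hM x hx)

/-- The divergence of a vector field. -/
noncomputable def divergence {N : ℕ} (F : EuclideanSpace ℝ (Fin N) → EuclideanSpace ℝ (Fin N))
    (x : EuclideanSpace ℝ (Fin N)) : ℝ :=
  ∑ i, (fderiv ℝ F x (EuclideanSpace.single i 1)) i

variable {N : ℕ} {Ω : Set (EuclideanSpace ℝ (Fin N))}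
  {F : EuclideanSpace ℝ (Fin N) → EuclideanSpace ℝ (Fin N)}

theorem RegularOn.fderiv_coord (hF : RegularOn Ω F) {x : EuclideanSpace ℝ (Fin N)} (hx : x ∈ Ω)
    (v : EuclideanSpace ℝ (Fin N)) (i : Fin N) :
    fderiv ℝ (fun x => F x i) x v = (fderiv ℝ F x v) i := by
  have h : HasFDerivAt (fun x => F x i)
      ((EuclideanSpace.proj i : EuclideanSpace ℝ (Fin N) →L[ℝ] ℝ).comp (fderiv ℝ F x)) x :=
    (EuclideanSpace.proj i : EuclideanSpace ℝ (Fin N) →L[ℝ] ℝ).hasFDerivAt.comp x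
      (hF.differentiableAt x hx).hasFDerivAt
  rw [h.fderiv]
  rfl

theorem RegularOn.coord (hF : RegularOn Ω F) (i : Fin N) : RegularOn Ω fun x => F x i :=
  hF.clm_comp (EuclideanSpace.proj i : EuclideanSpace ℝ (Fin N) →L[ℝ] ℝ)

theorem RegularOn.integrableOn_divergence (hF : RegularOn Ω F) (ho : IsOpen Ω)
    (hb : Bornology.IsBounded Ω) : IntegrableOn (divergence F) Ω := by
  refine integrable_finsetSum _ fun i _ => ?_
  exact (EuclideanSpace.proj i : EuclideanSpace ℝ (Fin N) →L[ℝ] ℝ).integrable_comp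
    (hF.integrable_fderiv_apply ho hb (EuclideanSpace.single i 1))

theorem RegularOn.integral_divergence (hF : RegularOn Ω F) (ho : IsOpen Ω)
    (hb : Bornology.IsBounded Ω) : ∫ x in Ω, divergence F x =
      ∑ i, ∫ x in Ω, fderiv ℝ (fun x => F x i) x (EuclideanSpace.single i 1) := by
  rw [← integral_finsetSum _ fun i _ => (hF.coord i).integrable_fderiv_apply ho hb _]
  refine setIntegral_congr_fun ho.measurableSet fun x hx => ?_
  simp only [divergence]
  exact Finset.sum_congr rfl fun i _ => (hF.fderiv_coord hx _ i).symm

theorem RegularOn.integral_fderiv_apply_le {f : EuclideanSpace ℝ (Fin N) → ℝ}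
    (hf : RegularOn Ω f) (ho : IsOpen Ω)
    (hb : Bornology.IsBounded Ω) (hH : μHE[N - 1] (frontier Ω) ≠ ⊤)
    (c : EuclideanSpace ℝ (Fin N)) :
    ∫ x in Ω, fderiv ℝ f x c ≤ ‖c‖ * ∫ x in frontier Ω, |f x| ∂μHE[N - 1] := by
  rcases eq_or_ne c 0 with rfl | hc
  · simp
  have hc' : c = ‖c‖ • (‖c‖⁻¹ • c) := by
    rw [smul_smul, mul_inv_cancel₀ (norm_ne_zero_iff.2 hc), one_smul]
  have hunit : ‖‖c‖⁻¹ • c‖ = 1 := norm_smul_inv_norm (𝕜 := ℝ) hc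
  obtain ⟨M, hM⟩ := hf.bounded_fderiv
  have hN : finrank ℝ (EuclideanSpace ℝ (Fin N)) = N := by simp
  have h := PoincareKorn.integral_fderiv_apply_le hunit ho hb (by rwa [hN]) hf.continuous
    hf.hasCompactSupport hf.differentiableAt hM
  rw [hN] at h
  calc ∫ x in Ω, fderiv ℝ f x c = ∫ x in Ω, ‖c‖ * fderiv ℝ f x (‖c‖⁻¹ • c) := by
        congr 1 with x
        conv_lhs => rw [hc', map_smul, smul_eq_mul]
    _ = ‖c‖ * ∫ x in Ω, fderiv ℝ f x (‖c‖⁻¹ • c) := integral_const_mul _ _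
    _ ≤ _ := by gcongr

theorem RegularOn.integrableOn_norm {W : Type*} [NormedAddCommGroup W] [NormedSpace ℝ W]
    {F : EuclideanSpace ℝ (Fin N) → W} (hF : RegularOn Ω F)
    {μ : Measure (EuclideanSpace ℝ (Fin N))} [IsFiniteMeasure μ] :
    Integrable (fun x => ‖F x‖) μ := by
  obtain ⟨C, hC⟩ := hF.hasCompactSupport.exists_bound_of_continuous hF.continuous
  exact Integrable.of_bound hF.continuous.norm.aestronglyMeasurable C
    (Eventually.of_forall fun x => by simpa using hC x)

/-- Coordinatewise summation loses a factor `N`. This is harmless because the bound is applied only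
to a small remainder. -/
theorem RegularOn.integral_divergence_le_mul (hF : RegularOn Ω F) (ho : IsOpen Ω)
    (hb : Bornology.IsBounded Ω) (hH : μHE[N - 1] (frontier Ω) ≠ ⊤) :
    ∫ x in Ω, divergence F x ≤ N * ∫ x in frontier Ω, ‖F x‖ ∂μHE[N - 1] := by
  have : IsFiniteMeasure ((μHE[N - 1] : Measure (EuclideanSpace ℝ (Fin N))).restrict (frontier Ω)) :=
    ⟨by simpa using hH.lt_top⟩
  rw [hF.integral_divergence ho hb]
  calc _ ≤ ∑ i : Fin N, ∫ x in frontier Ω, ‖F x‖ ∂μHE[N - 1] := by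
        refine Finset.sum_le_sum fun i _ => ?_
        refine ((hF.coord i).integral_fderiv_apply_le ho hb hH _).trans ?_
        rw [PiLp.norm_single, norm_one, one_mul]
        refine integral_mono (hF.coord i).integrableOn_norm hF.integrableOn_norm fun x => ?_
        exact PiLp.norm_apply_le (F x) i
    _ = _ := by simp

theorem divergence_add {G : EuclideanSpace ℝ (Fin N) → EuclideanSpace ℝ (Fin N)}
    {x : EuclideanSpace ℝ (Fin N)} (hF : DifferentiableAt ℝ F x) (hG : DifferentiableAt ℝ G x) :
    divergence (fun x => F x + G x) x = divergence F x + divergence G x := by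
  simp only [divergence, fderiv_fun_add hF hG]
  simp [Finset.sum_add_distrib]

theorem divergence_smul_const {φ : EuclideanSpace ℝ (Fin N) → ℝ} {x : EuclideanSpace ℝ (Fin N)}
    (hφ : DifferentiableAt ℝ φ x) (c : EuclideanSpace ℝ (Fin N)) :
    divergence (fun x => φ x • c) x = fderiv ℝ φ x c := by
  simp only [divergence, fderiv_smul_const hφ c]
  conv_rhs => rw [← (EuclideanSpace.basisFun (Fin N) ℝ).sum_repr c]
  simp [mul_comm]

/-- Localized form of the divergence inequality, where the field is nearly constant. -/
theorem RegularOn.integral_divergence_smul_le (hF : RegularOn Ω F) (ho : IsOpen Ω)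
    (hb : Bornology.IsBounded Ω) (hH : μHE[N - 1] (frontier Ω) ≠ ⊤)
    {φ : EuclideanSpace ℝ (Fin N) → ℝ} (hφ : ContDiff ℝ 1 φ) (hφc : HasCompactSupport φ)
    (hφ0 : ∀ x, 0 ≤ φ x) {c : EuclideanSpace ℝ (Fin N)} {η : ℝ}
    (hη : ∀ x, φ x ≠ 0 → ‖F x - c‖ ≤ η) :
    ∫ x in Ω, divergence (fun x => φ x • F x) x ≤
      ∫ x in frontier Ω, φ x * (‖F x‖ + (N + 1) * η) ∂μHE[N - 1] := by
  have : IsFiniteMeasure ((μHE[N - 1] : Measure (EuclideanSpace ℝ (Fin N))).restrict (frontier Ω)) :=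
    ⟨by simpa using hH.lt_top⟩
  have hφF : RegularOn Ω fun x => φ x • F x :=
    hF.comp_prodMk hb (Φ := fun z => φ z.1 • z.2) (by fun_prop) hφc.smul_right
  have hφG : RegularOn Ω fun x => φ x • (F x - c) :=
    hF.comp_prodMk hb (Φ := fun z => φ z.1 • (z.2 - c)) (by fun_prop) hφc.smul_right
  have hφR : RegularOn Ω φ :=
    hF.comp_prodMk hb (Φ := fun z => φ z.1) (by fun_prop) hφc
  have hφC : RegularOn Ω fun x => φ x • c :=
    hF.comp_prodMk hb (Φ := fun z => φ z.1 • c) (by fun_prop) hφc.smul_right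
  have hi1 : Integrable (fun x => φ x * ‖F x‖)
      ((μHE[N - 1] : Measure (EuclideanSpace ℝ (Fin N))).restrict (frontier Ω)) := by
    refine hφF.integrableOn_norm.congr (Eventually.of_forall fun x => ?_)
    simp [norm_smul, abs_of_nonneg (hφ0 x)]
  have hi2 : Integrable φ
      ((μHE[N - 1] : Measure (EuclideanSpace ℝ (Fin N))).restrict (frontier Ω)) := by
    refine hφR.integrableOn_norm.congr (Eventually.of_forall fun x => ?_)
    simp [abs_of_nonneg (hφ0 x)]
  -- The part `φ c` contributes a single directional derivative and so no dimensional factor. The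
  -- remainder costs `N η`, and replacing `‖c‖` by `‖F x‖` costs another `η`.
  calc ∫ x in Ω, divergence (fun x => φ x • F x) x
      = ∫ x in Ω, (divergence (fun x => φ x • (F x - c)) x + fderiv ℝ φ x c) := by
        refine setIntegral_congr_fun ho.measurableSet fun x hx => ?_
        rw [← divergence_smul_const (hφR.differentiableAt x hx) c,
          ← divergence_add (hφG.differentiableAt x hx) (hφC.differentiableAt x hx)]
        simp [smul_sub]
    _ = (∫ x in Ω, divergence (fun x => φ x • (F x - c)) x) + ∫ x in Ω, fderiv ℝ φ x c :=
        integral_add (hφG.integrableOn_divergence ho hb) (hφR.integrable_fderiv_apply ho hb c)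
    _ ≤ N * (∫ x in frontier Ω, ‖φ x • (F x - c)‖ ∂μHE[N - 1]) +
          ‖c‖ * ∫ x in frontier Ω, |φ x| ∂μHE[N - 1] :=
        add_le_add (hφG.integral_divergence_le_mul ho hb hH)
          (hφR.integral_fderiv_apply_le ho hb hH c)
    _ = ∫ x in frontier Ω, (N * ‖φ x • (F x - c)‖ + ‖c‖ * |φ x|) ∂μHE[N - 1] := by
        rw [← integral_const_mul, ← integral_const_mul]
        exact (integral_add (hφG.integrableOn_norm.const_mul _)
          (hφR.integrableOn_norm.const_mul _)).symm
    _ ≤ _ := by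
        refine integral_mono
          ((hφG.integrableOn_norm.const_mul _).add (hφR.integrableOn_norm.const_mul _)) ?_ fun x => ?_
        · simp only [mul_add]
          exact hi1.add (hi2.mul_const _)
        · by_cases h0 : φ x = 0
          · simp [h0]
          have h1 := hη x h0
          have h2 : ‖c‖ ≤ ‖F x‖ + η := by
            have := norm_sub_norm_le c (F x)
            rw [norm_sub_rev] at this
            linarith
          simp only [norm_smul, Real.norm_eq_abs, abs_of_nonneg (hφ0 x)]
          have h3 : φ x * (N * ‖F x - c‖) ≤ φ x * (N * η) := by
            gcongr; exact hφ0 x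
          have h4 : φ x * ‖c‖ ≤ φ x * (‖F x‖ + η) := by
            gcongr; exact hφ0 x
          linarith

/-- A finite smooth partition of unity subordinate to small balls. -/
theorem exists_partition_of_unity {K : Set (EuclideanSpace ℝ (Fin N))} (hK : IsCompact K) {ρ : ℝ}
    (hρ : 0 < ρ) : ∃ (ι : Type) (_ : Fintype ι) (c : ι → EuclideanSpace ℝ (Fin N))
      (φ : ι → EuclideanSpace ℝ (Fin N) → ℝ), (∀ i, ContDiff ℝ 1 (φ i)) ∧
      (∀ i, HasCompactSupport (φ i)) ∧ (∀ i x, 0 ≤ φ i x) ∧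
      (∀ i x, φ i x ≠ 0 → dist x (c i) < ρ) ∧ ∀ x ∈ K, ∑ i, φ i x = 1 := by
  obtain ⟨s, -, hs⟩ := hK.elim_nhds_subcover (fun x => Metric.ball x ρ)
    fun x _ => Metric.ball_mem_nhds x hρ
  obtain ⟨m, ⟨e⟩⟩ := Finite.exists_equiv_fin s
  let c : Fin m → EuclideanSpace ℝ (Fin N) := fun i => e.symm i
  obtain ⟨f, hf⟩ := SmoothPartitionOfUnity.exists_isSubordinate
    (modelWithCornersSelf ℝ (EuclideanSpace ℝ (Fin N))) hK.isClosed
    (fun i => Metric.ball (c i) ρ) (fun i => Metric.isOpen_ball) (fun x hx => by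
      obtain ⟨y, hy, hxy⟩ := mem_iUnion₂.1 (hs hx)
      refine mem_iUnion.2 ⟨e ⟨y, hy⟩, ?_⟩
      simpa [c] using hxy)
  refine ⟨Fin m, inferInstance, c, fun i => f i, fun i => ?_, fun i => ?_, fun i x => f.nonneg i x,
    fun i x hx => ?_, fun x hx => ?_⟩
  · exact (f i).contMDiff.contDiff.of_le (by exact_mod_cast le_top)
  · exact HasCompactSupport.of_support_subset_isCompact
      (isCompact_closedBall (c i) ρ)
      ((subset_tsupport _).trans ((hf i).trans Metric.ball_subset_closedBall))
  · exact hf i (subset_tsupport _ hx)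
  · have := f.sum_eq_one hx
    rwa [finsum_eq_sum_of_fintype] at this

/-- For a bounded open set whose boundary has finite `(N - 1)`-dimensional measure, the integral of
the divergence of a field is at most the boundary integral of its norm. -/
theorem RegularOn.integral_divergence_le (hF : RegularOn Ω F) (ho : IsOpen Ω)
    (hb : Bornology.IsBounded Ω) (hH : μHE[N - 1] (frontier Ω) ≠ ⊤) :
    ∫ x in Ω, divergence F x ≤ ∫ x in frontier Ω, ‖F x‖ ∂μHE[N - 1] := by
  have : IsFiniteMeasure ((μHE[N - 1] : Measure (EuclideanSpace ℝ (Fin N))).restrict (frontier Ω)) :=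
    ⟨by simpa using hH.lt_top⟩
  have hbound : ∀ η : ℝ, 0 < η → ∫ x in Ω, divergence F x ≤
      (∫ x in frontier Ω, ‖F x‖ ∂μHE[N - 1]) +
        (N + 1) * η * (μHE[N - 1] : Measure (EuclideanSpace ℝ (Fin N))).real (frontier Ω) := by
    intro η hη
    obtain ⟨ρ, hρ, hu⟩ := Metric.uniformContinuous_iff.1
      (hF.hasCompactSupport.uniformContinuous_of_continuous hF.continuous) η hη
    -- At scale `ρ` the field differs from its value at each centre by less than `η`.
    obtain ⟨ι, _, c, φ, hφ, hφc, hφ0, hφρ, hφ1⟩ :=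
      exists_partition_of_unity hb.isCompact_closure hρ
    have hφF : ∀ i, RegularOn Ω fun x => φ i x • F x := fun i =>
      hF.comp_prodMk hb (Φ := fun z => φ i z.1 • z.2)
        (((hφ i).comp contDiff_fst).smul contDiff_snd) (hφc i).smul_right
    have hsum : ∀ x ∈ Ω, divergence F x = ∑ i, divergence (fun x => φ i x • F x) x := by
      intro x hx
      have heq : F =ᶠ[𝓝 x] fun x => ∑ i, φ i x • F x := by
        filter_upwards [ho.mem_nhds hx] with y hy
        rw [← Finset.sum_smul, hφ1 y (subset_closure hy), one_smul]
      simp only [divergence]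
      rw [Finset.sum_comm]
      refine Finset.sum_congr rfl fun j _ => ?_
      rw [heq.fderiv_eq, fderiv_fun_sum fun i _ => (hφF i).differentiableAt x hx]
      simp
    have hint : ∀ i, Integrable (fun x => φ i x * (‖F x‖ + (N + 1) * η))
        ((μHE[N - 1] : Measure (EuclideanSpace ℝ (Fin N))).restrict (frontier Ω)) := by
      intro i
      have hreg : RegularOn Ω (φ i) :=
        hF.comp_prodMk hb (Φ := fun z => φ i z.1) ((hφ i).comp contDiff_fst) (hφc i)
      simp only [mul_add]
      refine Integrable.add ?_ (Integrable.mul_const ?_ _)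
      · refine (hφF i).integrableOn_norm.congr (Eventually.of_forall fun x => ?_)
        simp [norm_smul, abs_of_nonneg (hφ0 i x)]
      · refine hreg.integrableOn_norm.congr (Eventually.of_forall fun x => ?_)
        simp [abs_of_nonneg (hφ0 i x)]
    calc ∫ x in Ω, divergence F x = ∫ x in Ω, ∑ i, divergence (fun x => φ i x • F x) x :=
          setIntegral_congr_fun ho.measurableSet hsum
      _ = ∑ i, ∫ x in Ω, divergence (fun x => φ i x • F x) x :=
          integral_finsetSum _ fun i _ => (hφF i).integrableOn_divergence ho hb
      _ ≤ ∑ i, ∫ x in frontier Ω, φ i x * (‖F x‖ + (N + 1) * η) ∂μHE[N - 1] := by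
          refine Finset.sum_le_sum fun i _ => hF.integral_divergence_smul_le ho hb hH (hφ i) (hφc i)
            (hφ0 i) (c := F (c i)) fun x hx => ?_
          rw [← dist_eq_norm]
          exact (hu (hφρ i x hx)).le
      _ = ∫ x in frontier Ω, ∑ i, φ i x * (‖F x‖ + (N + 1) * η) ∂μHE[N - 1] :=
          (integral_finsetSum _ fun i _ => hint i).symm
      _ = ∫ x in frontier Ω, (‖F x‖ + (N + 1) * η) ∂μHE[N - 1] := by
          refine setIntegral_congr_fun isClosed_frontier.measurableSet fun x hx => ?_
          rw [← Finset.sum_mul, hφ1 x (frontier_subset_closure hx), one_mul]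
      _ = _ := by
          rw [integral_add hF.integrableOn_norm (integrable_const _), setIntegral_const,
            smul_eq_mul]
          ring
  have hlim : Tendsto (fun η : ℝ => (∫ x in frontier Ω, ‖F x‖ ∂μHE[N - 1]) +
        (N + 1) * η * (μHE[N - 1] : Measure (EuclideanSpace ℝ (Fin N))).real (frontier Ω))
      (𝓝[>] 0) (𝓝 (∫ x in frontier Ω, ‖F x‖ ∂μHE[N - 1])) := by
    refine Tendsto.mono_left ?_ nhdsWithin_le_nhds
    refine Continuous.tendsto' (by fun_prop) _ _ (by simp)
  exact ge_of_tendsto hlim (by filter_upwards [self_mem_nhdsWithin] with η hη using hbound η hη)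

end Divergence

/-! ### Finite surface measure of Lipschitz boundaries. -/

section LipschitzBoundary

variable {N : ℕ} {Ω : Set (EuclideanSpace ℝ (Fin N))}

theorem inner_eq_of_mem_frontier (ho : IsOpen Ω) {ξ e : EuclideanSpace ℝ (Fin N)} {r : ℝ}
    {γ : (Submodule.span ℝ {e})ᗮ → ℝ} (hγ : Continuous γ)
    (h : ∀ x ∈ Metric.ball ξ r,
      (x ∈ Ω ↔ ⟪e, x⟫ < γ ((Submodule.span ℝ {e})ᗮ.orthogonalProjectionOnto x)))
    {x : EuclideanSpace ℝ (Fin N)} (hx : x ∈ frontier Ω) (hxr : x ∈ Metric.ball ξ r) :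
    ⟪e, x⟫ = γ ((Submodule.span ℝ {e})ᗮ.orthogonalProjectionOnto x) := by
  have hnot : x ∉ Ω := by
    rw [ho.frontier_eq] at hx
    exact hx.2
  refine le_antisymm ?_ (not_lt.1 (mt (h x hxr).2 hnot))
  have hmem : x ∈ closure (Metric.ball ξ r ∩ Ω) :=
    Metric.isOpen_ball.inter_closure ⟨hxr, frontier_subset_closure hx⟩
  have hcl : IsClosed {y : EuclideanSpace ℝ (Fin N) |
      ⟪e, y⟫ ≤ γ ((Submodule.span ℝ {e})ᗮ.orthogonalProjectionOnto y)} :=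
    isClosed_le (by fun_prop) (hγ.comp (by fun_prop))
  exact closure_minimal (fun y hy => ((h y hy.1).1 hy.2).le) hcl hmem

/-- The graph map is Lipschitz with constant `K + 1` on the hyperplane orthogonal to `e`, where
`μHE` is Lebesgue measure. -/
theorem euclideanHausdorffMeasure_graph_lt_top {e : EuclideanSpace ℝ (Fin N)} (he : ‖e‖ = 1)
    {K : NNReal} {γ : (Submodule.span ℝ {e})ᗮ → ℝ} (hγ : LipschitzWith K γ)
    {s : Set (Submodule.span ℝ {e})ᗮ} (hs : Bornology.IsBounded s) :
    μHE[N - 1] ((fun y : (Submodule.span ℝ {e})ᗮ => γ y • e + (y : EuclideanSpace ℝ (Fin N))) '' s)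
      < ⊤ := by
  have he0 : e ≠ 0 := by rintro rfl; simp at he
  have hlip : LipschitzWith (K + 1)
      fun y : (Submodule.span ℝ {e})ᗮ => γ y • e + (y : EuclideanSpace ℝ (Fin N)) := by
    refine LipschitzWith.add ?_ (LipschitzWith.subtype_val _)
    refine LipschitzWith.of_dist_le_mul fun x y => ?_
    rw [dist_eq_norm, ← sub_smul, norm_smul, he, mul_one, ← dist_eq_norm]
    exact hγ.dist_le_mul x y
  refine (euclideanHausdorffMeasure_image_le hlip _ _).trans_lt ?_
  have hfr := finrank_orthogonal_span_singleton_eq he0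
  rw [finrank_euclideanSpace_fin] at hfr
  rw [← hfr, InnerProductSpace.euclideanHausdorffMeasure_eq_volume]
  exact ENNReal.mul_lt_top (by simp) hs.measure_lt_top

/-- The boundary of a bounded Lipschitz domain has finite surface measure. -/
theorem HasLipschitzBoundary.measure_frontier_ne_top (hL : HasLipschitzBoundary Ω) (ho : IsOpen Ω)
    (hb : Bornology.IsBounded Ω) : μHE[N - 1] (frontier Ω) ≠ ⊤ := by
  have hK : IsCompact (frontier Ω) :=
    hb.isCompact_closure.of_isClosed_subset isClosed_frontier frontier_subset_closure
  refine (hK.measure_lt_top_of_nhdsWithin fun ξ hξ => ?_).ne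
  obtain ⟨e, he, r, hr, K, γ, hγ, h⟩ := hL ξ hξ
  refine ⟨frontier Ω ∩ Metric.ball ξ r,
    inter_mem_nhdsWithin _ (Metric.ball_mem_nhds ξ hr), ?_⟩
  refine (measure_mono ?_).trans_lt (euclideanHausdorffMeasure_graph_lt_top he hγ
    (s := (Submodule.span ℝ {e})ᗮ.orthogonalProjectionOnto '' Metric.ball ξ r)
    ((Submodule.span ℝ {e})ᗮ.orthogonalProjectionOnto.lipschitz.isBounded_image
      Metric.isBounded_ball))
  rintro x ⟨hx, hxr⟩
  refine ⟨_, mem_image_of_mem _ hxr, ?_⟩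
  have h1 := inner_eq_of_mem_frontier ho hγ.continuous h hx hxr
  have h2 := (Submodule.span ℝ {e}).starProjection_add_starProjection_orthogonal x
  rw [Submodule.starProjection_unit_singleton ℝ he x] at h2
  simp only [← h1]
  exact h2

end LipschitzBoundary

/-! ### The auxiliary field and the pointwise inequality. -/

section Pointwise

variable {N : ℕ}

theorem frobenius_norm_sq (A : Matrix (Fin N) (Fin N) ℝ) : ‖A‖ ^ 2 = ∑ i, ∑ j, A i j ^ 2 := by
  rw [Matrix.frobenius_norm_def, ← Real.sqrt_eq_rpow, Real.sq_sqrt (by positivity)]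
  simp

/-- Cauchy–Schwarz over pairs of indices; the rank-one matrix `z wᵀ` has Frobenius norm `‖z‖ * ‖w‖`.
-/
theorem abs_sum_mul_le (A : Matrix (Fin N) (Fin N) ℝ) (z w : EuclideanSpace ℝ (Fin N)) :
    |∑ i, ∑ j, z i * w j * A i j| ≤ ‖z‖ * ‖w‖ * ‖A‖ := by
  refine abs_le_of_sq_le_sq ?_ (by positivity)
  have h := Finset.sum_mul_sq_le_sq_mul_sq (Finset.univ : Finset (Fin N × Fin N))
    (fun q => z q.1 * w q.2) (fun q => A q.1 q.2)
  simp only [Fintype.sum_prod_type] at h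
  refine h.trans (le_of_eq ?_)
  rw [mul_pow, mul_pow, frobenius_norm_sq, EuclideanSpace.norm_sq_eq, EuclideanSpace.norm_sq_eq,
    Finset.sum_mul_sum (s := Finset.univ) (t := Finset.univ) (f := fun i => ‖z i‖ ^ 2)]
  simp only [mul_pow, Real.norm_eq_abs, sq_abs]

theorem abs_trace_le (A : Matrix (Fin N) (Fin N) ℝ) : |∑ i, A i i| ≤ √N * ‖A‖ := by
  refine abs_le_of_sq_le_sq ?_ (by positivity)
  rw [mul_pow, Real.sq_sqrt (by positivity), frobenius_norm_sq]
  refine (sq_sum_le_card_mul_sum_sq (s := Finset.univ) (f := fun i => A i i)).trans ?_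
  rw [Finset.card_univ, Fintype.card_fin]
  gcongr with i
  exact Finset.single_le_sum (f := fun j => A i j ^ 2) (fun j _ => sq_nonneg _) (Finset.mem_univ i)

/-- The regularization of the field `|u|^p (x - x₀) + p |u|^(p - 2) ⟨u, x - x₀⟩ u`. -/
noncomputable def kornField (p ε : ℝ) (x₀ : EuclideanSpace ℝ (Fin N))
    (q : EuclideanSpace ℝ (Fin N) × EuclideanSpace ℝ (Fin N)) : EuclideanSpace ℝ (Fin N) :=
  ((‖q.2‖ ^ 2 + ε) ^ (p / 2) - ε ^ (p / 2)) • (q.1 - x₀) +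
    (p * (‖q.2‖ ^ 2 + ε) ^ (p / 2 - 1) * ⟪q.2, q.1 - x₀⟫) • q.2

/-- Positivity of `ε` keeps the base of the real powers away from zero, also at zeros of the field.
-/
theorem contDiff_kornField (p : ℝ) {ε : ℝ} (hε : 0 < ε) (x₀ : EuclideanSpace ℝ (Fin N)) :
    ContDiff ℝ 1 (kornField p ε x₀) := by
  have hs : ContDiff ℝ 1 fun q : EuclideanSpace ℝ (Fin N) × EuclideanSpace ℝ (Fin N) =>
      ‖q.2‖ ^ 2 + ε := (contDiff_snd.norm_sq ℝ).add contDiff_const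
  have hr : ∀ a : ℝ, ContDiff ℝ 1 fun q : EuclideanSpace ℝ (Fin N) × EuclideanSpace ℝ (Fin N) =>
      (‖q.2‖ ^ 2 + ε) ^ a := fun a => hs.rpow_const_of_ne fun q => by positivity
  have hi : ContDiff ℝ 1 fun q : EuclideanSpace ℝ (Fin N) × EuclideanSpace ℝ (Fin N) =>
      ⟪q.2, q.1 - x₀⟫ := contDiff_snd.inner ℝ (contDiff_fst.sub contDiff_const)
  exact (((hr _).sub contDiff_const).smul (contDiff_fst.sub contDiff_const)).add
    (((contDiff_const.mul (hr _)).mul hi).smul contDiff_snd)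

/-- This is the reason for subtracting `ε ^ (p / 2)` in the field: it vanishes wherever `u` does, so
compact support is inherited. -/
theorem kornField_zero (p ε : ℝ) (x₀ x : EuclideanSpace ℝ (Fin N)) :
    kornField p ε x₀ (x, 0) = 0 := by
  simp [kornField]

theorem sum_apply_single_mul (a : EuclideanSpace ℝ (Fin N) →L[ℝ] ℝ)
    (z : EuclideanSpace ℝ (Fin N)) : ∑ i, a (EuclideanSpace.single i 1) * z i = a z := by
  conv_rhs => rw [← (EuclideanSpace.basisFun (Fin N) ℝ).sum_repr z]
  simp [mul_comm]

theorem divergence_kornField {p ε : ℝ} (hε : 0 < ε) (x₀ : EuclideanSpace ℝ (Fin N))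
    {u : EuclideanSpace ℝ (Fin N) → EuclideanSpace ℝ (Fin N)} {x : EuclideanSpace ℝ (Fin N)}
    (hu : DifferentiableAt ℝ u x) :
    divergence (fun x => kornField p ε x₀ (x, u x)) x =
      N * ((‖u x‖ ^ 2 + ε) ^ (p / 2) - ε ^ (p / 2)) +
      p * (‖u x‖ ^ 2 + ε) ^ (p / 2 - 1) * ‖u x‖ ^ 2 +
      p * (‖u x‖ ^ 2 + ε) ^ (p / 2 - 1) * (⟪u x, fderiv ℝ u x (x - x₀)⟫ +
        ⟪fderiv ℝ u x (u x), x - x₀⟫) +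
      p * (p - 2) * (‖u x‖ ^ 2 + ε) ^ (p / 2 - 1 - 1) * ⟪u x, fderiv ℝ u x (u x)⟫ *
        ⟪u x, x - x₀⟫ +
      p * (‖u x‖ ^ 2 + ε) ^ (p / 2 - 1) * ⟪u x, x - x₀⟫ * divergence u x := by
  set L := fderiv ℝ u x
  have hL : HasFDerivAt u L x := hu.hasFDerivAt
  have hs : HasFDerivAt (fun x => ‖u x‖ ^ 2 + ε) ((2 : ℝ) • (innerSL ℝ (u x)).comp L) x := by
    simpa [two_smul] using hL.norm_sq.add_const ε
  have hpos : ‖u x‖ ^ 2 + ε ≠ 0 := by positivity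
  have hr : ∀ a : ℝ, HasFDerivAt (fun x => (‖u x‖ ^ 2 + ε) ^ a)
      ((a * (‖u x‖ ^ 2 + ε) ^ (a - 1)) • ((2 : ℝ) • (innerSL ℝ (u x)).comp L)) x :=
    fun a => hs.rpow_const (Or.inl hpos)
  have hz : HasFDerivAt (fun x => x - x₀) (ContinuousLinearMap.id ℝ (EuclideanSpace ℝ (Fin N))) x :=
    (hasFDerivAt_id x).sub_const x₀
  have hF := (((hr (p / 2)).sub_const (ε ^ (p / 2))).smul hz).add
    ((((hr (p / 2 - 1)).const_mul p).mul (hL.inner ℝ hz)).smul hL)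
  set z := x - x₀
  have hcoord : ∀ i, (fderiv ℝ (fun x => kornField p ε x₀ (x, u x)) x (EuclideanSpace.single i 1)) i =
      ((‖u x‖ ^ 2 + ε) ^ (p / 2) - ε ^ (p / 2)) * 1 +
      p * (‖u x‖ ^ 2 + ε) ^ (p / 2 - 1) * (⟪u x, L (EuclideanSpace.single i 1)⟫ * z i) +
      p * (‖u x‖ ^ 2 + ε) ^ (p / 2 - 1) * (⟪L (EuclideanSpace.single i 1), z⟫ * u x i) +
      p * (‖u x‖ ^ 2 + ε) ^ (p / 2 - 1) * (u x i * u x i) +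
      p * (p - 2) * (‖u x‖ ^ 2 + ε) ^ (p / 2 - 1 - 1) * ⟪u x, z⟫ *
        (⟪u x, L (EuclideanSpace.single i 1)⟫ * u x i) +
      p * (‖u x‖ ^ 2 + ε) ^ (p / 2 - 1) * ⟪u x, z⟫ * (L (EuclideanSpace.single i 1)) i := by
    intro i
    have h1 : fderiv ℝ (fun x => kornField p ε x₀ (x, u x)) x = _ := hF.fderiv
    rw [h1]
    simp [EuclideanSpace.inner_single_right]
    ring
  simp only [divergence, hcoord, Finset.sum_add_distrib, ← Finset.mul_sum]
  have e1 : ∑ i, ⟪u x, L (EuclideanSpace.single i 1)⟫ * z i = ⟪u x, L z⟫ :=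
    sum_apply_single_mul ((innerSL ℝ (u x)).comp L) z
  have e2 : ∑ i, ⟪u x, L (EuclideanSpace.single i 1)⟫ * u x i = ⟪u x, L (u x)⟫ :=
    sum_apply_single_mul ((innerSL ℝ (u x)).comp L) (u x)
  have e3 : ∑ i, ⟪L (EuclideanSpace.single i 1), z⟫ * u x i = ⟪L (u x), z⟫ := by
    simp only [fun v => real_inner_comm z (L v)]
    exact sum_apply_single_mul ((innerSL ℝ z).comp L) (u x)
  have e4 : ∑ i, u x i * u x i = ‖u x‖ ^ 2 := by
    rw [EuclideanSpace.norm_sq_eq]; simp [sq]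
  rw [e1, e2, e3, e4]
  simp only [Finset.sum_const, Finset.card_univ, Fintype.card_fin, nsmul_eq_mul]
  ring

/-- The antisymmetric part of the gradient cancels in the sum. The case `z = w` also covers `⟪w,
fderiv ℝ u x w⟫`. -/
theorem inner_fderiv_add_inner_fderiv (u : EuclideanSpace ℝ (Fin N) → EuclideanSpace ℝ (Fin N))
    (x z w : EuclideanSpace ℝ (Fin N)) :
    ⟪w, fderiv ℝ u x z⟫ + ⟪fderiv ℝ u x w, z⟫ =
      2 * ∑ i, ∑ j, z i * w j * symGrad u x i j := by
  set L := fderiv ℝ u x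
  have h1 : ∀ a b : EuclideanSpace ℝ (Fin N),
      ⟪b, L a⟫ = ∑ i, ∑ j, a i * b j * (L (EuclideanSpace.single i 1)) j := by
    intro a b
    rw [← show ∑ i, ⟪b, L (EuclideanSpace.single i 1)⟫ * a i = ⟪b, L a⟫ from
      sum_apply_single_mul ((innerSL ℝ b).comp L) a]
    refine Finset.sum_congr rfl fun i _ => ?_
    rw [PiLp.inner_apply, Finset.sum_mul]
    refine Finset.sum_congr rfl fun j _ => ?_
    simp
    ring
  rw [real_inner_comm z (L w), h1 z w, h1 w z, Finset.sum_comm (f := fun i j =>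
    w i * z j * (L (EuclideanSpace.single i 1)) j), ← Finset.sum_add_distrib, Finset.mul_sum]
  refine Finset.sum_congr rfl fun i _ => ?_
  rw [← Finset.sum_add_distrib, Finset.mul_sum]
  refine Finset.sum_congr rfl fun j _ => ?_
  simp only [symGrad, Matrix.of_apply]
  ring

theorem divergence_eq_trace_symGrad (u : EuclideanSpace ℝ (Fin N) → EuclideanSpace ℝ (Fin N))
    (x : EuclideanSpace ℝ (Fin N)) : divergence u x = ∑ i, symGrad u x i i := by
  simp [divergence, symGrad]

theorem norm_kornField_le {p ε : ℝ} (hp : 0 ≤ p) (hε : 0 < ε) (x₀ x w : EuclideanSpace ℝ (Fin N)) :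
    ‖kornField p ε x₀ (x, w)‖ ≤ (1 + p) * ‖x - x₀‖ * (‖w‖ ^ 2 + ε) ^ (p / 2) := by
  have hs : 0 < ‖w‖ ^ 2 + ε := by positivity
  have hq : (‖w‖ ^ 2 + ε) ^ (p / 2) = (‖w‖ ^ 2 + ε) ^ (p / 2 - 1) * (‖w‖ ^ 2 + ε) := by
    rw [← Real.rpow_add_one hs.ne', sub_add_cancel]
  have h1 : |(‖w‖ ^ 2 + ε) ^ (p / 2) - ε ^ (p / 2)| ≤ (‖w‖ ^ 2 + ε) ^ (p / 2) := by
    have hmono : ε ^ (p / 2) ≤ (‖w‖ ^ 2 + ε) ^ (p / 2) :=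
      Real.rpow_le_rpow hε.le (by nlinarith [sq_nonneg ‖w‖]) (by positivity)
    rw [abs_of_nonneg (by linarith)]
    linarith [Real.rpow_nonneg hε.le (p / 2)]
  have h2 := abs_real_inner_le_norm w (x - x₀)
  have hq0 : 0 ≤ (‖w‖ ^ 2 + ε) ^ (p / 2 - 1) := by positivity
  refine (norm_add_le _ _).trans ?_
  simp only [norm_smul, Real.norm_eq_abs, abs_mul, abs_of_nonneg hp, abs_of_nonneg hq0]
  calc _ ≤ (‖w‖ ^ 2 + ε) ^ (p / 2) * ‖x - x₀‖ +
        p * (‖w‖ ^ 2 + ε) ^ (p / 2 - 1) * (‖w‖ * ‖x - x₀‖) * ‖w‖ := by gcongr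
    _ = (‖w‖ ^ 2 + ε) ^ (p / 2) * ‖x - x₀‖ +
        p * ((‖w‖ ^ 2 + ε) ^ (p / 2 - 1) * ‖w‖ ^ 2) * ‖x - x₀‖ := by ring
    _ ≤ (‖w‖ ^ 2 + ε) ^ (p / 2) * ‖x - x₀‖ +
        p * ((‖w‖ ^ 2 + ε) ^ (p / 2 - 1) * (‖w‖ ^ 2 + ε)) * ‖x - x₀‖ := by
        gcongr; linarith
    _ = _ := by rw [← hq]; ring

/-- The pointwise inequality behind the Poincaré–Korn inequality. -/
theorem rpow_le_divergence_kornField {p ε : ℝ} (hp : 1 ≤ p) (hε : 0 < ε)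
    (x₀ : EuclideanSpace ℝ (Fin N))
    {u : EuclideanSpace ℝ (Fin N) → EuclideanSpace ℝ (Fin N)} {x : EuclideanSpace ℝ (Fin N)}
    (hu : DifferentiableAt ℝ u x) :
    (‖u x‖ ^ 2 + ε) ^ (p / 2) ≤ (constC p N * ‖x - x₀‖ * ‖symGrad u x‖) ^ p +
      p / (p + N) * divergence (fun x => kornField p ε x₀ (x, u x)) x +
      p / (p + N) * (N * ε ^ (p / 2) + p * (√ε * (‖u x‖ ^ 2 + ε) ^ ((p - 1) / 2))) := by
  have hp0 : 0 < p := by linarith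
  have hpN : 0 < p + N := by positivity
  set U := ‖u x‖ with hU
  set s := U ^ 2 + ε with hs_def
  have hs : 0 < s := by positivity
  set r := √s with hr_def
  have hr : 0 < r := Real.sqrt_pos.2 hs
  have hrs : r * r = s := Real.mul_self_sqrt hs.le
  set q := s ^ (p / 2 - 1) with hq_def
  have hq : 0 ≤ q := by positivity
  have hP : s ^ (p / 2) = q * s := by rw [hq_def, ← Real.rpow_add_one hs.ne', sub_add_cancel]
  have hq' : s ^ (p / 2 - 1 - 1) * s = q := by
    rw [← Real.rpow_add_one hs.ne', sub_add_cancel]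
  have hm : s ^ ((p - 1) / 2) = q * r := by
    rw [hq_def, hr_def, Real.sqrt_eq_rpow, ← Real.rpow_add hs]
    congr 1; ring
  have hUr : U ≤ r := Real.le_sqrt_of_sq_le (by rw [hs_def]; linarith)
  have hεr : √ε ≤ r := Real.sqrt_le_sqrt (by rw [hs_def]; nlinarith)
  have hεε : √ε * √ε = ε := Real.mul_self_sqrt hε.le
  have hU0 : 0 ≤ U := norm_nonneg _
  set ζ := ‖x - x₀‖
  set σ := ‖symGrad u x‖
  have hζ : 0 ≤ ζ := norm_nonneg _
  have hσ : 0 ≤ σ := norm_nonneg _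
  set a := constC p N * ζ * σ with ha_def
  have ha : 0 ≤ a := by rw [ha_def, constC]; positivity
  have hCp : (p + N) * a = p * (2 + |p - 2| + √N) * (ζ * σ) := by
    rw [ha_def, constC]; field_simp
  -- Young's inequality for `s ^ ((p - 1) / 2) * a`, with weights `1 - 1 / p` and `1 / p`; the first
  -- weight may vanish, so `p = 1` is included.
  have hyoung : p * (q * r * a) ≤ (p - 1) * (q * s) + a ^ p := by
    have h := Real.geom_mean_le_arith_mean2_weighted (w₁ := 1 - 1 / p) (w₂ := 1 / p)
      (p₁ := s ^ (p / 2)) (p₂ := a ^ p)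
      (by rw [sub_nonneg, div_le_one hp0]; exact hp) (by positivity) (by positivity)
      (by positivity) (by ring)
    rw [← Real.rpow_mul hs.le, ← Real.rpow_mul ha, mul_one_div_cancel hp0.ne', Real.rpow_one,
      show p / 2 * (1 - 1 / p) = (p - 1) / 2 by field_simp, hm, hP] at h
    calc p * (q * r * a) ≤ p * ((1 - 1 / p) * (q * s) + 1 / p * a ^ p) := by gcongr
      _ = _ := by field_simp
  have hdiv := divergence_kornField (p := p) hε x₀ hu
  have hb1 : |⟪u x, fderiv ℝ u x (x - x₀)⟫ + ⟪fderiv ℝ u x (u x), x - x₀⟫| ≤ 2 * (ζ * U * σ) := by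
    rw [inner_fderiv_add_inner_fderiv, abs_mul, abs_two]
    gcongr
    exact abs_sum_mul_le _ _ _
  have hb2 : |⟪u x, fderiv ℝ u x (u x)⟫| ≤ U * U * σ := by
    have h1 := inner_fderiv_add_inner_fderiv u x (u x) (u x)
    rw [real_inner_comm (u x) (fderiv ℝ u x (u x)), ← two_mul] at h1
    rw [mul_left_cancel₀ two_ne_zero h1]
    exact abs_sum_mul_le _ _ _
  have hb3 : |⟪u x, x - x₀⟫| ≤ U * ζ := abs_real_inner_le_norm _ _
  have hb4 : |divergence u x| ≤ √N * σ := by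
    rw [divergence_eq_trace_symGrad]; exact abs_trace_le _
  rw [← hU, ← hs_def, ← hq_def, hP] at hdiv
  set q' := s ^ (p / 2 - 1 - 1)
  have hq'0 : 0 ≤ q' := by positivity
  have hqU : q * U ≤ q * r := by gcongr
  have hq'U : q' * (U * U * U) ≤ q * r := by
    calc q' * (U * U * U) ≤ q' * (r * r * r) := by gcongr
      _ = q * r := by rw [hrs, ← hq']; ring
  -- The three first-order terms of the divergence account for the summands `2`, `|p - 2|` and `√N`
  -- of the constant.
  have ht1 : -(2 * (q * r * (ζ * σ))) ≤
      q * (⟪u x, fderiv ℝ u x (x - x₀)⟫ + ⟪fderiv ℝ u x (u x), x - x₀⟫) := by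
    have h1 : q * (2 * (ζ * U * σ)) ≤ 2 * (q * r * (ζ * σ)) := by
      calc q * (2 * (ζ * U * σ)) = 2 * (q * U * (ζ * σ)) := by ring
        _ ≤ _ := by gcongr
    have h2 := mul_le_mul_of_nonneg_left (neg_le_of_abs_le hb1) hq
    linarith
  have ht2 : -(|p - 2| * (q * r * (ζ * σ))) ≤
      (p - 2) * q' * ⟪u x, fderiv ℝ u x (u x)⟫ * ⟪u x, x - x₀⟫ := by
    refine neg_le_of_abs_le ?_
    rw [abs_mul, abs_mul, abs_mul, abs_of_nonneg hq'0]
    calc |p - 2| * q' * |⟪u x, fderiv ℝ u x (u x)⟫| * |⟪u x, x - x₀⟫|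
        ≤ |p - 2| * q' * (U * U * σ) * (U * ζ) := by gcongr
      _ = |p - 2| * (q' * (U * U * U) * (ζ * σ)) := by ring
      _ ≤ _ := by gcongr
  have ht3 : -(√N * (q * r * (ζ * σ))) ≤ q * ⟪u x, x - x₀⟫ * divergence u x := by
    refine neg_le_of_abs_le ?_
    rw [abs_mul, abs_mul, abs_of_nonneg hq]
    calc q * |⟪u x, x - x₀⟫| * |divergence u x| ≤ q * (U * ζ) * (√N * σ) := by gcongr
      _ = √N * (q * U * (ζ * σ)) := by ring
      _ ≤ _ := by gcongr
  -- For `p < 2` the factor `q` can blow up as `ε → 0`. Trading `√ε` for `r` leaves `√ε * s ^ ((p -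
  -- 1) / 2)`, which tends to zero locally uniformly because `p ≥ 1`.
  have hεq : ε * q ≤ √ε * (q * r) := by
    calc ε * q = √ε * (q * √ε) := by rw [mul_left_comm, hεε, mul_comm]
      _ ≤ _ := by gcongr
  have hmain : (p + N) * (q * s) - (p + N) * (q * r * a) -
      (N * ε ^ (p / 2) + p * (√ε * (q * r))) ≤
      divergence (fun x => kornField p ε x₀ (x, u x)) x := by
    rw [hdiv]
    have h1 : (p + N) * (q * r * a) = p * (2 + |p - 2| + √N) * (q * r * (ζ * σ)) := by
      calc (p + N) * (q * r * a) = q * r * ((p + N) * a) := by ring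
        _ = _ := by rw [hCp]; ring
    have h2 : q * U ^ 2 = q * s - ε * q := by rw [hs_def]; ring
    have k1 := mul_le_mul_of_nonneg_left ht1 hp0.le
    have k2 := mul_le_mul_of_nonneg_left ht2 hp0.le
    have k3 := mul_le_mul_of_nonneg_left ht3 hp0.le
    have k4 := mul_le_mul_of_nonneg_left hεq hp0.le
    rw [h1]
    have h3 : p * q * U ^ 2 = p * (q * s) - p * (ε * q) := by rw [mul_assoc, h2]; ring
    rw [h3]
    linarith
  -- This factor turns the leading term into `p * (q * s)`; Young's inequality takes away `p - 1`
  -- copies, so exactly one remains.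
  have hfin := mul_le_mul_of_nonneg_left hmain (show 0 ≤ p / (p + N) by positivity)
  have hexp : p / (p + N) * ((p + N) * (q * s) - (p + N) * (q * r * a) -
      (N * ε ^ (p / 2) + p * (√ε * (q * r)))) = p * (q * s) - p * (q * r * a) -
      p / (p + N) * (N * ε ^ (p / 2) + p * (√ε * (q * r))) := by
    field_simp
  rw [hexp] at hfin
  rw [hP, hm]
  linarith

end Pointwise

/-! ### Integration and the limit as the regularization vanishes. -/

section Integral

variable {N : ℕ} {Ω : Set (EuclideanSpace ℝ (Fin N))}
  {u : EuclideanSpace ℝ (Fin N) → EuclideanSpace ℝ (Fin N)}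

theorem measurable_norm_symGrad (u : EuclideanSpace ℝ (Fin N) → EuclideanSpace ℝ (Fin N)) :
    Measurable fun x => ‖symGrad u x‖ := by
  have h : (fun x => ‖symGrad u x‖) = fun x => √(∑ i, ∑ j, symGrad u x i j ^ 2) := by
    ext x
    rw [← frobenius_norm_sq, Real.sqrt_sq (norm_nonneg _)]
  rw [h]
  have hm : ∀ i j, Measurable fun x =>
      (fderiv ℝ u x (EuclideanSpace.single i 1)) j := fun i j =>
    (EuclideanSpace.proj j : EuclideanSpace ℝ (Fin N) →L[ℝ] ℝ).continuous.measurable.comp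
      (measurable_fderiv_apply_const ℝ u (EuclideanSpace.single i 1))
  refine Measurable.sqrt (Finset.measurable_fun_sum _ fun i _ =>
    Finset.measurable_fun_sum _ fun j _ => ?_)
  simp only [symGrad, Matrix.of_apply]
  exact (((hm i j).add (hm j i)).div_const 2).pow_const 2

theorem norm_symGrad_le (x : EuclideanSpace ℝ (Fin N)) : ‖symGrad u x‖ ≤ N * ‖fderiv ℝ u x‖ := by
  refine le_of_sq_le_sq ?_ (by positivity)
  rw [frobenius_norm_sq, mul_pow]
  have hent : ∀ i j, |(fderiv ℝ u x (EuclideanSpace.single i 1)) j| ≤ ‖fderiv ℝ u x‖ := by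
    intro i j
    refine (PiLp.norm_apply_le (fderiv ℝ u x (EuclideanSpace.single i 1)) j).trans ?_
    refine ((fderiv ℝ u x).le_opNorm _).trans ?_
    rw [PiLp.norm_single, norm_one, mul_one]
  calc ∑ i, ∑ j, symGrad u x i j ^ 2 ≤ ∑ _i : Fin N, ∑ _j : Fin N, ‖fderiv ℝ u x‖ ^ 2 := by
        refine Finset.sum_le_sum fun i _ => Finset.sum_le_sum fun j _ => ?_
        refine sq_le_sq' ?_ ?_ <;>
        · simp only [symGrad, Matrix.of_apply]
          have h1 := abs_le.1 (hent i j)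
          have h2 := abs_le.1 (hent j i)
          linarith [h1.1, h1.2, h2.1, h2.2]
    _ = _ := by simp; ring

theorem RegularOn.kornField (hu : RegularOn Ω u) (hb : Bornology.IsBounded Ω) (p : ℝ) {ε : ℝ}
    (hε : 0 < ε) (x₀ : EuclideanSpace ℝ (Fin N)) :
    RegularOn Ω fun x => kornField p ε x₀ (x, u x) := by
  refine hu.comp_prodMk hb (contDiff_kornField p hε x₀) ?_
  refine hu.hasCompactSupport.mono fun x hx => ?_
  contrapose! hx
  rw [Function.notMem_support] at hx ⊢
  rw [hx, kornField_zero]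

theorem integrableOn_weighted_symGrad (hu : RegularOn Ω u) (ho : IsOpen Ω)
    (hb : Bornology.IsBounded Ω) {p : ℝ} (hp : 0 ≤ p) {c : ℝ} (hc : 0 ≤ c)
    (x₀ : EuclideanSpace ℝ (Fin N)) :
    IntegrableOn (fun x => (c * ‖x - x₀‖ * ‖symGrad u x‖) ^ p) Ω := by
  obtain ⟨M, hM⟩ := hu.bounded_fderiv
  obtain ⟨R, hR⟩ := hb.exists_norm_le
  have hm := measurable_norm_symGrad u
  refine IntegrableOn.of_bound hb.measure_lt_top
    (by fun_prop) ((c * (R + ‖x₀‖) * (N * M)) ^ p) ?_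
  filter_upwards [ae_restrict_mem ho.measurableSet] with x hx
  rw [Real.norm_of_nonneg (by positivity)]
  have h1 : ‖x - x₀‖ ≤ R + ‖x₀‖ := (norm_sub_le _ _).trans (by gcongr; exact hR x hx)
  have h2 : ‖symGrad u x‖ ≤ N * M := (norm_symGrad_le x).trans (by gcongr; exact hM x hx)
  have h3 : 0 ≤ R + ‖x₀‖ := (norm_nonneg _).trans h1
  gcongr

theorem norm_sq_rpow_half {W : Type*} [NormedAddCommGroup W] (w : W) (p : ℝ) :
    (‖w‖ ^ 2) ^ (p / 2) = ‖w‖ ^ p := by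
  rw [← Real.rpow_natCast, ← Real.rpow_mul (norm_nonneg _)]
  congr 1
  push_cast
  ring

/-- The bounds `‖u x‖ ≤ B` and `ε ≤ 1` make the pointwise error uniform in `x`, so it integrates to
a multiple of the volume that vanishes with `ε`. -/
theorem integral_regularized_le {p ε : ℝ} (hp : 1 ≤ p) (hε : 0 < ε) (hε1 : ε ≤ 1)
    (hu : RegularOn Ω u) (ho : IsOpen Ω) (hb : Bornology.IsBounded Ω)
    (x₀ : EuclideanSpace ℝ (Fin N)) {B : ℝ} (hB : ∀ x, ‖u x‖ ≤ B) :
    ∫ x in Ω, ‖u x‖ ^ p ≤ (∫ x in Ω, (constC p N * ‖x - x₀‖ * ‖symGrad u x‖) ^ p) +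
      p / (p + N) * (∫ x in Ω, divergence (fun x => kornField p ε x₀ (x, u x)) x) +
      p / (p + N) * (N * ε ^ (p / 2) + p * (√ε * (B ^ 2 + 1) ^ ((p - 1) / 2))) *
        volume.real Ω := by
  have hfin : IsFiniteMeasure (volume.restrict Ω) := ⟨by simpa using hb.measure_lt_top⟩
  have hp0 : 0 < p := by linarith
  have hB0 : 0 ≤ B := (norm_nonneg _).trans (hB 0)
  have hC : 0 ≤ constC p N := by rw [constC]; positivity
  have hi1 := integrableOn_weighted_symGrad hu ho hb hp0.le hC x₀
  have hi2 := ((hu.kornField hb p hε x₀).integrableOn_divergence ho hb).const_mul (p / (p + N))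
  set e := p / (p + N) * (N * ε ^ (p / 2) + p * (√ε * (B ^ 2 + 1) ^ ((p - 1) / 2)))
  calc ∫ x in Ω, ‖u x‖ ^ p ≤ ∫ x in Ω, ((constC p N * ‖x - x₀‖ * ‖symGrad u x‖) ^ p +
        p / (p + N) * divergence (fun x => kornField p ε x₀ (x, u x)) x + e) := by
        refine setIntegral_mono_on ?_ ((hi1.add hi2).add (integrable_const e)) ho.measurableSet
          fun x hx => ?_
        · refine IntegrableOn.of_bound hb.measure_lt_top ?_ (B ^ p) (Eventually.of_forall fun x => ?_)
          · exact (hu.continuous.norm.rpow_const fun x => Or.inr hp0.le).aestronglyMeasurable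
          · rw [Real.norm_of_nonneg (by positivity)]
            gcongr
            exact hB x
        · have h := rpow_le_divergence_kornField hp hε x₀ (hu.differentiableAt x hx)
          have h1 : ‖u x‖ ^ p ≤ (‖u x‖ ^ 2 + ε) ^ (p / 2) := by
            rw [← norm_sq_rpow_half]
            gcongr
            linarith
          have h2 : p / (p + N) * (N * ε ^ (p / 2) +
              p * (√ε * (‖u x‖ ^ 2 + ε) ^ ((p - 1) / 2))) ≤ e := by
            have : 0 ≤ (p - 1) / 2 := by linarith
            have := hB x
            simp only [e]
            gcongr
          linarith
    _ = _ := by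
        rw [integral_add (hi1.fun_add hi2) (integrable_const e), integral_add hi1 hi2,
          integral_const_mul, setIntegral_const, smul_eq_mul, mul_comm e]

theorem tendsto_integral_regularized {p : ℝ} (hp : 1 ≤ p) (hu : Continuous u) {B : ℝ}
    (hB : ∀ x, ‖u x‖ ≤ B) (σ : Measure (EuclideanSpace ℝ (Fin N))) [IsFiniteMeasure σ] :
    Tendsto (fun ε : ℝ => ∫ x, (‖u x‖ ^ 2 + ε) ^ (p / 2) ∂σ) (𝓝[>] 0)
      (𝓝 (∫ x, ‖u x‖ ^ p ∂σ)) := by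
  have hp2 : 0 ≤ p / 2 := by linarith
  refine tendsto_integral_filter_of_dominated_convergence (fun _ => (B ^ 2 + 1) ^ (p / 2)) ?_ ?_
    (integrable_const _) ?_
  · refine Eventually.of_forall fun ε => Continuous.aestronglyMeasurable ?_
    exact ((hu.norm.pow 2).add continuous_const).rpow_const fun x => Or.inr hp2
  · filter_upwards [Ioc_mem_nhdsGT (zero_lt_one' ℝ)] with ε hε
    refine Eventually.of_forall fun x => ?_
    have h1 := hε.1
    have h2 := hε.2
    have h3 := hB x
    rw [Real.norm_of_nonneg (by positivity)]
    gcongr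
  · refine Eventually.of_forall fun x => Tendsto.mono_left ?_ nhdsWithin_le_nhds
    refine Continuous.tendsto' ?_ _ _ (by rw [add_zero, norm_sq_rpow_half])
    exact (continuous_const.add continuous_id).rpow_const fun x => Or.inr hp2

/-- The Poincaré–Korn inequality, given an upper bound for the flux of the auxiliary fields. -/
theorem integral_norm_rpow_le {p : ℝ} (hp : 1 ≤ p) (hu : RegularOn Ω u) (ho : IsOpen Ω)
    (hb : Bornology.IsBounded Ω) (x₀ : EuclideanSpace ℝ (Fin N))
    (σ : Measure (EuclideanSpace ℝ (Fin N))) [IsFiniteMeasure σ] {D : ℝ}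
    (hD : ∀ᵐ x ∂σ, ‖x - x₀‖ ≤ D)
    (hflux : ∀ ε : ℝ, 0 < ε → ∫ x in Ω, divergence (fun x => kornField p ε x₀ (x, u x)) x ≤
      ∫ x, ‖kornField p ε x₀ (x, u x)‖ ∂σ) :
    ∫ x in Ω, ‖u x‖ ^ p ≤ (∫ x in Ω, (constC p N * ‖x - x₀‖ * ‖symGrad u x‖) ^ p) +
      p * ((p + 1) / (p + N)) * D * ∫ x, ‖u x‖ ^ p ∂σ := by
  obtain ⟨B, hB⟩ := hu.hasCompactSupport.exists_bound_of_continuous hu.continuous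
  have hB0 : 0 ≤ B := (norm_nonneg _).trans (hB 0)
  have hp0 : 0 < p := by linarith
  set I := ∫ x in Ω, (constC p N * ‖x - x₀‖ * ‖symGrad u x‖) ^ p
  have hstep : ∀ ε ∈ Ioc (0 : ℝ) 1, ∫ x in Ω, ‖u x‖ ^ p ≤
      I + p / (p + N) * ((1 + p) * D * ∫ x, (‖u x‖ ^ 2 + ε) ^ (p / 2) ∂σ) +
      p / (p + N) * (N * ε ^ (p / 2) + p * (√ε * (B ^ 2 + 1) ^ ((p - 1) / 2))) *
        volume.real Ω := by
    rintro ε ⟨hε, hε1⟩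
    refine (integral_regularized_le hp hε hε1 hu ho hb x₀ hB).trans ?_
    gcongr
    refine (hflux ε hε).trans ?_
    rw [← integral_const_mul]
    refine integral_mono_ae (hu.kornField hb p hε x₀).integrableOn_norm ?_ ?_
    · refine Integrable.const_mul (Integrable.of_bound ?_ ((B ^ 2 + ε) ^ (p / 2))
        (Eventually.of_forall fun x => ?_)) _
      · exact (((hu.continuous.norm.pow 2).add continuous_const).rpow_const fun x =>
          Or.inr (by positivity)).aestronglyMeasurable
      · have := hB x
        rw [Real.norm_of_nonneg (by positivity)]
        gcongr
    · filter_upwards [hD] with x hx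
      refine (norm_kornField_le hp0.le hε x₀ x (u x)).trans ?_
      gcongr
  have hlim : Tendsto (fun ε : ℝ =>
      I + p / (p + N) * ((1 + p) * D * ∫ x, (‖u x‖ ^ 2 + ε) ^ (p / 2) ∂σ) +
      p / (p + N) * (N * ε ^ (p / 2) + p * (√ε * (B ^ 2 + 1) ^ ((p - 1) / 2))) *
        volume.real Ω) (𝓝[>] 0)
      (𝓝 (I + p / (p + N) * ((1 + p) * D * ∫ x, ‖u x‖ ^ p ∂σ) + 0)) := by
    refine Tendsto.add (Tendsto.add tendsto_const_nhds (Tendsto.const_mul _ (Tendsto.const_mul _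
      (tendsto_integral_regularized hp hu.continuous hB σ)))) (Tendsto.mono_left ?_
        nhdsWithin_le_nhds)
    have hr : Continuous fun ε : ℝ => ε ^ (p / 2) :=
      continuous_id.rpow_const fun x => Or.inr (by positivity)
    refine Continuous.tendsto' (by fun_prop) _ _ ?_
    rw [Real.zero_rpow (by positivity)]
    simp
  have h := ge_of_tendsto hlim
    (by filter_upwards [Ioc_mem_nhdsGT (zero_lt_one' ℝ)] with ε hε using hstep ε hε)
  refine h.trans (le_of_eq ?_)
  ring

end Integral

/-! ### Extended-valued integrals, compact support, and smoothness up to the boundary. -/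

section Main

variable {N : ℕ} {Ω : Set (EuclideanSpace ℝ (Fin N))}
  {u : EuclideanSpace ℝ (Fin N) → EuclideanSpace ℝ (Fin N)}

theorem constC_pos {p : ℝ} (hp : 1 ≤ p) (N : ℕ) : 0 < constC p N := by
  have : 0 < p := by linarith
  rw [constC]
  positivity

theorem ofReal_integral_norm_rpow {W : Type*} [NormedAddCommGroup W] {p : ℝ} (hp : 0 ≤ p)
    {f : EuclideanSpace ℝ (Fin N) → W} {μ : Measure (EuclideanSpace ℝ (Fin N))}
    (hf : Integrable (fun x => ‖f x‖ ^ p) μ) :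
    ENNReal.ofReal (∫ x, ‖f x‖ ^ p ∂μ) = ∫⁻ x, ‖f x‖ₑ ^ p ∂μ := by
  rw [ofReal_integral_eq_lintegral_ofReal hf (Eventually.of_forall fun x => by positivity)]
  refine lintegral_congr fun x => ?_
  rw [← ENNReal.ofReal_rpow_of_nonneg (norm_nonneg _) hp, ofReal_norm]

theorem RegularOn.integrable_norm_rpow {p : ℝ} (hp : 0 ≤ p) (hu : RegularOn Ω u)
    (μ : Measure (EuclideanSpace ℝ (Fin N))) [IsFiniteMeasure μ] :
    Integrable (fun x => ‖u x‖ ^ p) μ := by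
  obtain ⟨B, hB⟩ := hu.hasCompactSupport.exists_bound_of_continuous hu.continuous
  refine Integrable.of_bound
    (hu.continuous.norm.rpow_const fun x => Or.inr hp).aestronglyMeasurable (B ^ p)
    (Eventually.of_forall fun x => ?_)
  have := hB x
  rw [Real.norm_of_nonneg (by positivity)]
  gcongr

/-- A common form for both cases: `σ` will be zero for compactly supported fields and the surface
measure of the boundary otherwise. -/
theorem lintegral_enorm_rpow_le {p : ℝ} (hp : 1 ≤ p) (hu : RegularOn Ω u) (ho : IsOpen Ω)
    (hb : Bornology.IsBounded Ω) (x₀ : EuclideanSpace ℝ (Fin N))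
    (σ : Measure (EuclideanSpace ℝ (Fin N))) [IsFiniteMeasure σ] {D : ℝ} (hD0 : 0 ≤ D)
    (hD : ∀ᵐ x ∂σ, ‖x - x₀‖ ≤ D)
    (hflux : ∀ ε : ℝ, 0 < ε → ∫ x in Ω, divergence (fun x => kornField p ε x₀ (x, u x)) x ≤
      ∫ x, ‖kornField p ε x₀ (x, u x)‖ ∂σ) :
    ∫⁻ x in Ω, ‖u x‖ₑ ^ p ≤
      ENNReal.ofReal (constC p N ^ p) * (∫⁻ x in Ω, ‖x - x₀‖ₑ ^ p * ‖symGrad u x‖ₑ ^ p) +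
      ENNReal.ofReal (p * ((p + 1) / (p + N)) * D) * ∫⁻ x, ‖u x‖ₑ ^ p ∂σ := by
  have hp0 : 0 ≤ p := by linarith
  have hC := (constC_pos hp N).le
  have : IsFiniteMeasure (volume.restrict Ω) := ⟨by simpa using hb.measure_lt_top⟩
  have h := ENNReal.ofReal_le_ofReal (integral_norm_rpow_le hp hu ho hb x₀ σ hD hflux)
  rw [ENNReal.ofReal_add (integral_nonneg fun x => by positivity)
      (mul_nonneg (by positivity) (integral_nonneg fun x => by positivity)),
    ENNReal.ofReal_mul (by positivity),
    ofReal_integral_norm_rpow hp0 (hu.integrable_norm_rpow hp0 _),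
    ofReal_integral_norm_rpow hp0 (hu.integrable_norm_rpow hp0 _),
    ofReal_integral_eq_lintegral_ofReal (integrableOn_weighted_symGrad hu ho hb hp0 hC x₀)
      (Eventually.of_forall fun x => by positivity)] at h
  refine h.trans (le_of_eq ?_)
  congr 1
  rw [← lintegral_const_mul' _ _ ENNReal.ofReal_ne_top]
  refine lintegral_congr fun x => ?_
  rw [Real.mul_rpow (by positivity) (by positivity), Real.mul_rpow (by positivity) (by positivity),
    ENNReal.ofReal_mul (by positivity), ENNReal.ofReal_mul (by positivity), mul_assoc,
    ← ENNReal.ofReal_rpow_of_nonneg (norm_nonneg (x - x₀)) hp0,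
    ← ENNReal.ofReal_rpow_of_nonneg (norm_nonneg (symGrad u x)) hp0, ofReal_norm, ofReal_norm]

theorem lintegral_weight_le {p : ℝ} (hp : 0 ≤ p) (hm : MeasurableSet Ω)
    {x₀ : EuclideanSpace ℝ (Fin N)} {c D : ℝ} (hc : 0 ≤ c) (hD0 : 0 ≤ D)
    (hD : ∀ x ∈ Ω, ‖x - x₀‖ ≤ D) :
    ENNReal.ofReal (c ^ p) * (∫⁻ x in Ω, ‖x - x₀‖ₑ ^ p * ‖symGrad u x‖ₑ ^ p) ≤
      ENNReal.ofReal ((D * c) ^ p) * ∫⁻ x in Ω, ‖symGrad u x‖ₑ ^ p := by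
  rw [mul_comm D c, Real.mul_rpow hc hD0, ENNReal.ofReal_mul (by positivity), mul_assoc]
  gcongr
  rw [← lintegral_const_mul' _ _ ENNReal.ofReal_ne_top]
  refine setLIntegral_mono' hm fun x hx => ?_
  gcongr
  rw [← ENNReal.ofReal_rpow_of_nonneg hD0 hp]
  gcongr
  rw [← ofReal_norm]
  exact ENNReal.ofReal_le_ofReal (hD x hx)

/-- Integration by parts against the constant function `1`, one coordinate direction at a time. -/
theorem integral_divergence_eq_zero
    {F : EuclideanSpace ℝ (Fin N) → EuclideanSpace ℝ (Fin N)} (hF : ContDiff ℝ 1 F)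
    (hc : HasCompactSupport F) : ∫ x, divergence F x = 0 := by
  have hi : ∀ i, Integrable fun x => (fderiv ℝ F x (EuclideanSpace.single i 1)) := fun i =>
    ((hF.continuous_fderiv one_ne_zero).clm_apply continuous_const).integrable_of_hasCompactSupport
      (hc.fderiv_apply (𝕜 := ℝ) _)
  have hi' : ∀ i, Integrable fun x => (fderiv ℝ F x (EuclideanSpace.single i 1)) i := fun i =>
    (EuclideanSpace.proj i : EuclideanSpace ℝ (Fin N) →L[ℝ] ℝ).integrable_comp (hi i)
  simp only [divergence]
  rw [integral_finsetSum _ fun i _ => hi' i]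
  refine Finset.sum_eq_zero fun i _ => ?_
  have h0 : ∫ x, fderiv ℝ F x (EuclideanSpace.single i 1) = 0 := by
    have h := integral_smul_fderiv_eq_neg_fderiv_smul_of_integrable (𝕜 := ℝ) (μ := volume)
      (f := fun _ : EuclideanSpace ℝ (Fin N) => (1 : ℝ)) (g := F) (v := EuclideanSpace.single i 1)
      (by simp) (by simpa using hi i)
      (by simpa using hF.continuous.integrable_of_hasCompactSupport hc)
      (fun x _ => differentiableAt_const _) fun x _ => (hF.differentiable one_ne_zero).differentiableAt
    simpa using h
  have h1 := (EuclideanSpace.proj i : EuclideanSpace ℝ (Fin N) →L[ℝ] ℝ).integral_comp_comm (hi i)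
  rw [h0, map_zero] at h1
  exact h1

theorem regularOn_of_contDiff (hu : ContDiff ℝ 1 u) (hc : HasCompactSupport u) : RegularOn Ω u := by
  obtain ⟨M, hM⟩ := (hc.fderiv (𝕜 := ℝ)).exists_bound_of_continuous
    (hu.continuous_fderiv one_ne_zero)
  exact ⟨hu.continuous, hc, fun x _ => (hu.differentiable one_ne_zero).differentiableAt, M,
    fun x _ => hM x⟩

theorem setLIntegral_eq_lintegral_of_subset {s K : Set (EuclideanSpace ℝ (Fin N))}
    (hs : MeasurableSet s) (hK : K ⊆ s) {h : EuclideanSpace ℝ (Fin N) → ℝ≥0∞}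
    (h0 : ∀ x ∉ K, h x = 0) : ∫⁻ x in s, h x = ∫⁻ x, h x := by
  rw [← lintegral_indicator hs]
  refine lintegral_congr fun x => ?_
  by_cases hx : x ∈ s
  · rw [indicator_of_mem hx]
  · rw [indicator_of_notMem hx, h0 x fun h => hx (hK h)]

/-- The weighted Poincaré–Korn inequality for compactly supported fields. -/
theorem lintegral_enorm_rpow_le_of_tsupport_subset {p : ℝ} (hp : 1 ≤ p) (hu : ContDiff ℝ 1 u)
    (hc : HasCompactSupport u) (ho : IsOpen Ω) (hsupp : tsupport u ⊆ Ω)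
    (x₀ : EuclideanSpace ℝ (Fin N)) :
    ∫⁻ x in Ω, ‖u x‖ₑ ^ p ≤
      ENNReal.ofReal (constC p N ^ p) * ∫⁻ x in Ω, ‖x - x₀‖ₑ ^ p * ‖symGrad u x‖ₑ ^ p := by
  have hp0 : 0 < p := by linarith
  -- `Ω` may be unbounded, so the estimate is applied on a ball containing the support. All
  -- integrands vanish off the support, so the ball can then be exchanged for `Ω`.
  obtain ⟨R, hR⟩ := hc.isCompact.isBounded.subset_ball (0 : EuclideanSpace ℝ (Fin N))
  have h := lintegral_enorm_rpow_le hp (regularOn_of_contDiff hu hc) Metric.isOpen_ball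
    (Metric.isBounded_ball (x := (0 : EuclideanSpace ℝ (Fin N))) (r := R)) x₀ 0 le_rfl (by simp)
    fun ε hε => by
      have hreg := (regularOn_of_contDiff (Ω := Metric.ball 0 R) hu hc).kornField
        Metric.isBounded_ball p hε x₀
      have hcd : ContDiff ℝ 1 fun x => kornField p ε x₀ (x, u x) :=
        (contDiff_kornField p hε x₀).comp (contDiff_id.prodMk hu)
      rw [setIntegral_eq_integral_of_forall_compl_eq_zero,
        integral_divergence_eq_zero hcd hreg.hasCompactSupport]
      · simp
      · intro x hx
        have hev : (fun x => kornField p ε x₀ (x, u x)) =ᶠ[𝓝 x] fun _ => 0 := by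
          filter_upwards [notMem_tsupport_iff_eventuallyEq.1 fun h => hx (hR h)] with y hy
          rw [hy, Pi.zero_apply, kornField_zero]
        simp [divergence, hev.fderiv_eq]
  have h1 : ∀ x ∉ tsupport u, ‖u x‖ₑ ^ p = 0 := fun x hx => by
    simp [image_eq_zero_of_notMem_tsupport hx, hp0]
  have h2 : ∀ x ∉ tsupport u, ‖x - x₀‖ₑ ^ p * ‖symGrad u x‖ₑ ^ p = 0 := fun x hx => by
    have hS : symGrad u x = 0 := by
      ext i j
      simp [symGrad, (notMem_tsupport_iff_eventuallyEq.1 hx).fderiv_eq]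
    simp [hS, hp0]
  rw [setLIntegral_eq_lintegral_of_subset measurableSet_ball hR h1,
    setLIntegral_eq_lintegral_of_subset measurableSet_ball hR h2] at h
  rw [setLIntegral_eq_lintegral_of_subset ho.measurableSet hsupp h1,
    setLIntegral_eq_lintegral_of_subset ho.measurableSet hsupp h2]
  simpa using h

/-- The values of `u` off the closure are arbitrary. They are replaced by a Tietze extension times a
cut-off equal to one on the closure; the continuous extension of the first derivative to this
compact set bounds it on `Ω`. -/
theorem SmoothUpToBoundary.exists_regularOn (hu : SmoothUpToBoundary Ω u) (ho : IsOpen Ω)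
    (hb : Bornology.IsBounded Ω) : ∃ v, RegularOn Ω v ∧ EqOn v u (closure Ω) := by
  obtain ⟨hsm, hcont, hder⟩ := hu
  obtain ⟨g, hg⟩ := ContinuousMap.exists_restrict_eq isClosed_closure
    (⟨(closure Ω).domRestrict u, hcont.domRestrict⟩ : C(closure Ω, EuclideanSpace ℝ (Fin N)))
  obtain ⟨χ, hχ1, -, hχc, -⟩ := exists_continuous_one_zero_of_isCompact hb.isCompact_closure
    isClosed_empty (disjoint_empty _)
  have heq : EqOn (fun x => χ x • g x) u (closure Ω) := by
    intro x hx
    have h1 : g x = u x := DFunLike.congr_fun hg ⟨x, hx⟩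
    simp only [hχ1 hx, h1, Pi.one_apply, one_smul]
  have hev : ∀ x ∈ Ω, (fun x => χ x • g x) =ᶠ[𝓝 x] u := fun x hx => by
    filter_upwards [ho.mem_nhds hx] with y hy using heq (subset_closure hy)
  refine ⟨fun x => χ x • g x, ⟨χ.continuous.smul g.continuous, hχc.smul_right, fun x hx => ?_, ?_⟩,
    heq⟩
  · exact ((hsm.differentiableOn (by simp)).differentiableAt (ho.mem_nhds hx)).congr_of_eventuallyEq
      (hev x hx)
  · obtain ⟨d, hd, hdu⟩ := hder 1
    obtain ⟨M, hM⟩ := hb.isCompact_closure.exists_bound_of_continuousOn hd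
    refine ⟨M, fun x hx => ?_⟩
    rw [(hev x hx).fderiv_eq, ← norm_iteratedFDeriv_one, ← hdu x hx]
    exact hM x (subset_closure hx)

theorem diam_pos_of_isOpen (hN : 1 ≤ N) (ho : IsOpen Ω) (hb : Bornology.IsBounded Ω)
    (hne : Ω.Nonempty) : 0 < Metric.diam Ω := by
  have : Nontrivial (EuclideanSpace ℝ (Fin N)) := by
    have : Nonempty (Fin N) := ⟨⟨0, hN⟩⟩
    infer_instance
  refine Metric.diam_pos ?_ hb
  obtain ⟨x, hx⟩ := hne
  exact (infinite_of_mem_nhds x (ho.mem_nhds hx)).nontrivial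

theorem norm_sub_le_diam (hb : Bornology.IsBounded Ω) {x y : EuclideanSpace ℝ (Fin N)}
    (hx : x ∈ closure Ω) (hy : y ∈ Ω) : ‖x - y‖ ≤ Metric.diam Ω := by
  rw [← Metric.diam_closure, ← dist_eq_norm]
  exact Metric.dist_le_diam_of_mem hb.closure hx (subset_closure hy)

/-- The Poincaré–Korn inequality with a boundary term. -/
theorem SmoothUpToBoundary.lintegral_enorm_rpow_le (hu : SmoothUpToBoundary Ω u) {p : ℝ}
    (hp : 1 ≤ p) (ho : IsOpen Ω) (hb : Bornology.IsBounded Ω) (hL : HasLipschitzBoundary Ω) :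
    ∫⁻ x in Ω, ‖u x‖ₑ ^ p ≤
      ENNReal.ofReal (constKappa p Ω ^ p) * (∫⁻ x in Ω, ‖symGrad u x‖ₑ ^ p) +
      ENNReal.ofReal (constKappaBdry p Ω) * ∫⁻ x in frontier Ω, ‖u x‖ₑ ^ p ∂μHE[N - 1] := by
  -- The centre is taken in `Ω`, so that its distance to every point of the closure is at most the
  -- diameter.
  rcases Ω.eq_empty_or_nonempty with rfl | ⟨x₀, hx₀⟩
  · simp
  have hp0 : 0 ≤ p := by linarith
  have hH := hL.measure_frontier_ne_top ho hb
  have : IsFiniteMeasure ((μHE[N - 1] : Measure (EuclideanSpace ℝ (Fin N))).restrict (frontier Ω)) :=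
    ⟨by simpa using hH.lt_top⟩
  obtain ⟨v, hv, hvu⟩ := hu.exists_regularOn ho hb
  have h := PoincareKorn.lintegral_enorm_rpow_le hp hv ho hb x₀
    ((μHE[N - 1] : Measure (EuclideanSpace ℝ (Fin N))).restrict (frontier Ω))
    (D := Metric.diam Ω) Metric.diam_nonneg (by
      filter_upwards [ae_restrict_mem isClosed_frontier.measurableSet] with x hx
      exact norm_sub_le_diam hb (frontier_subset_closure hx) hx₀)
    fun ε hε => (hv.kornField hb p hε x₀).integral_divergence_le ho hb hH
  have h' := h.trans (add_le_add_left (lintegral_weight_le hp0 ho.measurableSet (constC_pos hp N).le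
    Metric.diam_nonneg fun x hx => norm_sub_le_diam hb (subset_closure hx) hx₀) _)
  have e1 : ∫⁻ x in Ω, ‖v x‖ₑ ^ p = ∫⁻ x in Ω, ‖u x‖ₑ ^ p :=
    setLIntegral_congr_fun ho.measurableSet fun x hx => by rw [hvu (subset_closure hx)]
  have e2 : ∫⁻ x in Ω, ‖symGrad v x‖ₑ ^ p = ∫⁻ x in Ω, ‖symGrad u x‖ₑ ^ p := by
    refine setLIntegral_congr_fun ho.measurableSet fun x hx => ?_
    have hev : v =ᶠ[𝓝 x] u := by
      filter_upwards [ho.mem_nhds hx] with y hy using hvu (subset_closure hy)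
    have : symGrad v x = symGrad u x := by simp only [symGrad, hev.fderiv_eq]
    rw [this]
  have e3 : ∫⁻ x in frontier Ω, ‖v x‖ₑ ^ p ∂μHE[N - 1] =
      ∫⁻ x in frontier Ω, ‖u x‖ₑ ^ p ∂μHE[N - 1] :=
    setLIntegral_congr_fun isClosed_frontier.measurableSet fun x hx => by
      rw [hvu (frontier_subset_closure hx)]
  rwa [e1, e2, e3] at h'

end Main

end PoincareKorn

theorem theorem1 (N : ℕ) (hN : 1 ≤ N) (p : ℝ) (hp : 1 ≤ p)
    (Ω : TopologicalSpace.Opens (EuclideanSpace ℝ (Fin N))) :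
    (0 < PoincareKorn.constC p N ∧
      ∀ u : 𝓓(Ω, EuclideanSpace ℝ (Fin N)),
        ∫⁻ x in (Ω : Set (EuclideanSpace ℝ (Fin N))), ‖u x‖ₑ ^ p ≤
          ENNReal.ofReal (PoincareKorn.constC p N ^ p) *
            ∫⁻ x in (Ω : Set (EuclideanSpace ℝ (Fin N))),
              ‖x‖ₑ ^ p * ‖PoincareKorn.symGrad u x‖ₑ ^ p) ∧
    (Bornology.IsBounded (Ω : Set (EuclideanSpace ℝ (Fin N))) →
      ((Ω : Set (EuclideanSpace ℝ (Fin N))).Nonempty →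
        0 < PoincareKorn.constKappa p (Ω : Set (EuclideanSpace ℝ (Fin N)))) ∧
      ∀ u : 𝓓(Ω, EuclideanSpace ℝ (Fin N)),
        ∫⁻ x in (Ω : Set (EuclideanSpace ℝ (Fin N))), ‖u x‖ₑ ^ p ≤
          ENNReal.ofReal (PoincareKorn.constKappa p (Ω : Set (EuclideanSpace ℝ (Fin N))) ^ p) *
            ∫⁻ x in (Ω : Set (EuclideanSpace ℝ (Fin N))), ‖PoincareKorn.symGrad u x‖ₑ ^ p) ∧
    (Bornology.IsBounded (Ω : Set (EuclideanSpace ℝ (Fin N))) →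
      PoincareKorn.HasLipschitzBoundary (Ω : Set (EuclideanSpace ℝ (Fin N))) →
      ((Ω : Set (EuclideanSpace ℝ (Fin N))).Nonempty →
        0 < PoincareKorn.constKappa p (Ω : Set (EuclideanSpace ℝ (Fin N))) ∧
        0 < PoincareKorn.constKappaBdry p (Ω : Set (EuclideanSpace ℝ (Fin N)))) ∧
      ∀ u : EuclideanSpace ℝ (Fin N) → EuclideanSpace ℝ (Fin N),
        PoincareKorn.SmoothUpToBoundary (Ω : Set (EuclideanSpace ℝ (Fin N))) u →
        ∫⁻ x in (Ω : Set (EuclideanSpace ℝ (Fin N))), ‖u x‖ₑ ^ p ≤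
          ENNReal.ofReal (PoincareKorn.constKappa p (Ω : Set (EuclideanSpace ℝ (Fin N))) ^ p) *
            (∫⁻ x in (Ω : Set (EuclideanSpace ℝ (Fin N))), ‖PoincareKorn.symGrad u x‖ₑ ^ p) +
          ENNReal.ofReal (PoincareKorn.constKappaBdry p (Ω : Set (EuclideanSpace ℝ (Fin N)))) *
            ∫⁻ x in frontier (Ω : Set (EuclideanSpace ℝ (Fin N))), ‖u x‖ₑ ^ p ∂μHE[N - 1]) := by
  have hp0 : 0 < p := by linarith
  have hC := PoincareKorn.constC_pos hp N
  have hκ : Bornology.IsBounded (Ω : Set (EuclideanSpace ℝ (Fin N))) →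
      (Ω : Set (EuclideanSpace ℝ (Fin N))).Nonempty →
        0 < PoincareKorn.constKappa p (Ω : Set (EuclideanSpace ℝ (Fin N))) := fun hb hne =>
    mul_pos (PoincareKorn.diam_pos_of_isOpen hN Ω.isOpen hb hne) hC
  -- The free centre serves twice: `x₀ = 0` gives the weighted inequality, and `x₀ ∈ Ω` the one with
  -- the diameter.
  have hw : ∀ (u : 𝓓(Ω, EuclideanSpace ℝ (Fin N))) (x₀ : EuclideanSpace ℝ (Fin N)),
      ∫⁻ x in (Ω : Set (EuclideanSpace ℝ (Fin N))), ‖u x‖ₑ ^ p ≤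
        ENNReal.ofReal (PoincareKorn.constC p N ^ p) *
          ∫⁻ x in (Ω : Set (EuclideanSpace ℝ (Fin N))),
            ‖x - x₀‖ₑ ^ p * ‖PoincareKorn.symGrad u x‖ₑ ^ p := fun u x₀ =>
    PoincareKorn.lintegral_enorm_rpow_le_of_tsupport_subset hp (u.contDiff.of_le (by simp))
      u.hasCompactSupport Ω.isOpen u.tsupport_subset x₀
  refine ⟨⟨hC, fun u => by simpa using hw u 0⟩, fun hb => ⟨hκ hb, fun u => ?_⟩,
    fun hb hL => ⟨fun hne => ⟨hκ hb hne, ?_⟩, fun u hu =>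
      hu.lintegral_enorm_rpow_le hp Ω.isOpen hb hL⟩⟩
  · rcases (Ω : Set (EuclideanSpace ℝ (Fin N))).eq_empty_or_nonempty with h | ⟨x₀, hx₀⟩
    · simp [h]
    · exact (hw u x₀).trans (PoincareKorn.lintegral_weight_le hp0.le Ω.isOpen.measurableSet hC.le
        Metric.diam_nonneg fun x hx => PoincareKorn.norm_sub_le_diam hb (subset_closure hx) hx₀)
  · have := PoincareKorn.diam_pos_of_isOpen hN Ω.isOpen hb hne
    unfold PoincareKorn.constKappaBdry
    positivity
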